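/- Let $H$ be the complex Hilbert space with orthonormal basis $\{e_i\}_{i\in\mathbb Z}$, and $H=H_-\oplus H_+$ with $H_-$, $H_+$ the closed spans of the $e_i$ with $i<0$, $i\ge 0$ respectively. Let $\mathbb I$ be the set of multi-indices $I=(i_0<i_1<\cdots)$ of integers with $i_j=j$ for all large $j$, and let $\bigwedge$ be the space of all $\omega=\sum_{I\in\mathbb I}\pi_I e_I$ with $\sum_I|\pi_I|^2<\infty$ for which there is an $m$ such that $\pi_I\ne 0$ implies $i_j=j$ for all $j\ge m$. Let $\Gamma\subset\bigwedge$ be the Sato Grassmann cone, i.e. the set of all infinite wedge products $v_0\wedge v_1\wedge\cdots$ of vectors $v_i\in H$ such that, for all large $i$, $v_i-e_i$ lies in the closed span of $\{e_j: j>i\}$; the coordinate $\pi_I$ of such a product is the (eventually constant) limit of the $m\times m$ minors of the matrix $(v_0|v_1|\cdots)$ in the rows $i_0,\dots,i_{m-1}$ and the columns $v_0,\dots,v_{m-1}$. Let $\Gamma^{k,n}=\{v_1\wedge\cdots\wedge v_k: v_i\in\mathbb C^n\}\subset\bigwedge^k\mathbb C^n$. An operator $M$ on $H$ acts on wedge products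 by $\hat M(v_0\wedge v_1\wedge\cdots)=Mv_0\wedge Mv_1\wedge\cdots$, extended linearly to sums $\sum_I\pi_Ie_I$. Let $S:H\to H$ be a bounded operator which is almost lower triangular: for some $N\in\mathbb Z$ and every $i\ge N$, $Se_i$ lies in the closed span of $\{e_j: j>i\}$. For $\mathbf t=(t_1,t_2,\dots)$ such that $\sum_i t_iS^i$ converges (unconditionally in operator norm) put $E(\mathbf t)=\exp\sum_i t_iS^i$, and let $\tau^S_\omega(\mathbf t)$ be the coordinate of $\hat E(\mathbf t)\omega$ at $(0,1,2,\dots)$. Write $[x]=(x,-\tfrac{x^2}{2},\tfrac{x^3}{3},\dots)$, with $i$-th entry $-(-x)^i/i$, and $\Delta(x_1,\dots,x_m)=\det(x_i^{j-1})_{i,j=1}^m$. **Lemma.** Let $0<k<n$, let $S$ be as above with $\operatorname{rank}(S_{+-})\le 1$, where $S_{+-}:H_-\to H_+$ is the restriction of $S$ to $H_-$ followed by the orthogonal projection onto $H_+$, and let $\mathbf t$ be such that $\sum_i t_iS^i$ converges. (1) Let $\lambda_1,\dots,\lambda_n\in\mathbb C$ be such that $\sum_i -\frac{(-\lambda_r)^i}{i}S^i$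 converges for each $r$. Then, for all $\omega\in\bigwedge$, the limits and sums that define the functions below converge, and the map $\hat L_{k,n}:\bigwedge\to\bigwedge^k\mathbb C^n$ for which $\hat L_{k,n}(\omega)$ has the Plücker coordinates $$\hat\pi_{i_1,\dots,i_k}=\Delta(\lambda_{i_1},\dots,\lambda_{i_k})\,\tau^S_\omega(\mathbf t+[\lambda_{i_1}]+\cdots+[\lambda_{i_k}]),\qquad 1\le i_1<\cdots<i_k\le n,$$ is linear and Grassmann cone preserving: $\hat L_{k,n}(\Gamma)\subset\Gamma^{k,n}$. Consequently, for $\omega\in\Gamma$, the numbers $\hat\pi$, defined by the same formula for arbitrary index tuples, satisfy the Plücker relations $$\sum_{l=1}^{k+1}(-1)^l\,\hat\pi_{i_1,\dots,i_{k-1},j_l}\,\hat\pi_{j_1,\dots,j_{l-1},j_{l+1},\dots,j_{k+1}}=0$$ for all indices $i_1,\dots,i_{k-1},j_1,\dots,j_{k+1}\in\{1,\dots,n\}$. (2) For arbitrary $x_1,\dots,x_k\in\mathbb C$ extend $\tau^S_\omega(\mathbf t+[x_1]+\cdots+[x_k])$ as the coordinate at $(0,1,2,\dots)$ of the image of $\omega$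 under $(I+x_1S)\cdots(I+x_kS)E(\mathbf t)$. This agrees with the original whenever the series $\sum_i-\frac{(-x_a)^i}{i}S^i$ converge, and with this extension all of (1) holds for arbitrary $\lambda_1,\dots,\lambda_n\in\mathbb C$. -/

import Mathlib

open Filter Topology

noncomputable section

namespace SatoKP

/-! ### The Hilbert space `H`, its splitting, and the block `S₊₋` -/

/-- The Hilbert space with orthonormal basis `e i`, `i ∈ ℤ`. -/
abbrev H : Type := lp (fun _ : ℤ => ℂ) 2

/-- The basis vector `e i`. -/
def e (i : ℤ) : H := lp.single 2 i (1 : ℂ)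

/-- The matrix entry in row `j` and column `i` of an operator, with respect to the basis `e`. -/
def entry (M : H →L[ℂ] H) (j i : ℤ) : ℂ := (M (e i)) j

/-- `H₊`, the closed span of the `e i` with `i ≥ 0`. -/
def Hplus : Submodule ℂ H := (Submodule.span ℂ (e '' {i : ℤ | 0 ≤ i})).topologicalClosure

/-- `H₋`, the closed span of the `e i` with `i < 0`. -/
def Hminus : Submodule ℂ H := (Submodule.span ℂ (e '' {i : ℤ | i < 0})).topologicalClosure

instance instCompleteSpaceHplus : CompleteSpace Hplus :=
  (Submodule.isClosed_topologicalClosure _).completeSpace_coe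

/-- The block `S₊₋ : H₋ → H₊` of `S`: restrict to `H₋`, then project orthogonally on `H₊`. -/
def blockPlusMinus (S : H →L[ℂ] H) : Hminus →L[ℂ] Hplus :=
  Hplus.orthogonalProjectionOnto ∘L S ∘L Hminus.subtypeL

/-- `S` is almost lower triangular: for the splitting of `H` at some index `N` it has the block form
`(A 0; C D)` with `D` strictly lower triangular. -/
def AlmostLowerTriangular (S : H →L[ℂ] H) : Prop :=
  ∃ N : ℤ, ∀ i : ℤ, N ≤ i → ∀ j : ℤ, j ≤ i → entry S j i = 0

/-! ### The wedge space and the Sato Grassmann cone -/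

/-- The multi-indices `I = (i₀ < i₁ < ⋯)` with `i_j = j` for all sufficiently large `j`. -/
def MultiIndex : Type :=
  {I : ℕ → ℤ // StrictMono I ∧ ∀ᶠ j : ℕ in atTop, I j = (j : ℤ)}

/-- The ground state `(0, 1, 2, …)`. -/
def ground : MultiIndex :=
  ⟨fun j => (j : ℤ), fun _ _ h => Int.ofNat_lt.mpr h, Eventually.of_forall fun _ => rfl⟩

/-- The wedge space: the elements `∑ π_I e_I`, represented by their coordinates `π`, that are square
summable and involve only multi-indices `I` with `i_j = j` for all `j ≥ m`, for some `m` which may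
depend on the element. In other words, it is the union over `m` of the Hilbert space exterior powers
`⋀^m ⟨e_i : i < m⟩`, embedded by `η ↦ η ∧ e_m ∧ e_{m+1} ∧ ⋯`. It contains every `e_I` and every
infinite wedge product `v₀ ∧ v₁ ∧ ⋯` with `v_i = e_i + ∑_{j > i} c_j e_j` for large `i`. -/
def Wedge : Submodule ℂ (MultiIndex → ℂ) where
  carrier := {π | Memℓp π 2 ∧
    ∃ m : ℕ, ∀ I : MultiIndex, π I ≠ 0 → ∀ j : ℕ, m ≤ j → I.1 j = (j : ℤ)}
  zero_mem' := ⟨zero_memℓp, 0, fun _ h => absurd rfl h⟩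
  add_mem' := by
    rintro π ρ ⟨hπ, m, hm⟩ ⟨hρ, m', hm'⟩
    refine ⟨hπ.add hρ, max m m', fun I hI j hj => ?_⟩
    by_cases h : π I = 0
    · have h' : ρ I ≠ 0 := by
        intro h'
        exact hI (by simp [h, h'])
      exact hm' I h' j (le_trans (le_max_right _ _) hj)
    · exact hm I h j (le_trans (le_max_left _ _) hj)
  smul_mem' := by
    rintro c π ⟨hπ, m, hm⟩
    refine ⟨hπ.const_smul c, m, fun I hI j hj => hm I ?_ j hj⟩
    intro h
    exact hI (by simp [h])

/-- The `m`-th leading principal minor of an infinite matrix. -/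
def truncDet (A : ℕ → ℕ → ℂ) (m : ℕ) : ℂ :=
  (Matrix.of fun a b : Fin m => A a b).det

/-- The determinant of an infinite matrix: the limit of its leading principal minors. -/
def infDet (A : ℕ → ℕ → ℂ) : ℂ := limUnder atTop (truncDet A)

/-- `ω = v₀ ∧ v₁ ∧ v₂ ∧ ⋯`: the coordinate of `ω` at `I` is the infinite determinant of the
coordinates of the vectors `v` in the rows `I`. -/
def IsInfiniteWedge (ω : Wedge) (v : ℕ → H) : Prop :=
  ∀ I : MultiIndex,
    Tendsto (truncDet fun a b => (v b) (I.1 a)) atTop (𝓝 ((ω : MultiIndex → ℂ) I))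

/-- The Sato Grassmann cone `Γ`: the elements `v₀ ∧ v₁ ∧ ⋯` where `v_i = e_i + ∑_{j > i} c_j e_j` for
all sufficiently large `i`. -/
def satoCone : Set Wedge :=
  {ω | ∃ v : ℕ → H,
    (∃ m : ℕ, ∀ i : ℕ, m ≤ i → (v i) (i : ℤ) = 1 ∧ ∀ j : ℤ, j < i → (v i) j = 0) ∧
    IsInfiniteWedge ω v}

/-! ### The action of operators on the wedge space and the function `τ` -/

/-- The coordinate at `J` of `M̂ e_I = M e_{i₀} ∧ M e_{i₁} ∧ ⋯`, a minor of `M`. -/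
def minor (M : H →L[ℂ] H) (J I : MultiIndex) : ℂ :=
  infDet fun a b => entry M (J.1 a) (I.1 b)

/-- The coordinate at `J` of `M̂ ω`, where `M̂ (∑ π_I e_I) = ∑ π_I M̂ e_I`. -/
def hatCoord (M : H →L[ℂ] H) (ω : Wedge) (J : MultiIndex) : ℂ :=
  ∑' I : MultiIndex, (ω : MultiIndex → ℂ) I * minor M J I

/-- All limits and sums in the definition of `hatCoord M ω J` converge. -/
def HatCoordConverges (M : H →L[ℂ] H) (ω : Wedge) (J : MultiIndex) : Prop :=
  (∀ I : MultiIndex, ∃ d : ℂ,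
    Tendsto (truncDet fun a b => entry M (J.1 a) (I.1 b)) atTop (𝓝 d)) ∧
  Summable fun I : MultiIndex => (ω : MultiIndex → ℂ) I * minor M J I

/-- The time variables `t = (t₁, t₂, …)` are such that `∑ tᵢ Sⁱ` converges in operator norm. -/
def TimeConverges (S : H →L[ℂ] H) (t : ℕ+ → ℂ) : Prop :=
  Summable fun i : ℕ+ => t i • S ^ (i : ℕ)

/-- The flow `E(t) = exp (∑ tᵢ Sⁱ)`. -/
def flow (S : H →L[ℂ] H) (t : ℕ+ → ℂ) : H →L[ℂ] H :=
  NormedSpace.exp (∑' i : ℕ+, t i • S ^ (i : ℕ))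

/-- `τ^S_ω(t)`, the coordinate at the ground state `(0, 1, 2, …)` of `Ê(t) ω`. -/
def tau (S : H →L[ℂ] H) (ω : Wedge) (t : ℕ+ → ℂ) : ℂ :=
  hatCoord (flow S t) ω ground

/-- The Miwa shift vector `[x] = (x, -x²/2, x³/3, …)`, with `i`-th entry `-(-x)ⁱ / i`. -/
def miwa (x : ℂ) : ℕ+ → ℂ := fun i => -(-x) ^ (i : ℕ) / ((i : ℕ) : ℂ)

/-- `τ^S_ω(t + [x₁] + ⋯ + [x_m])`. -/
def shiftedTau (S : H →L[ℂ] H) (t : ℕ+ → ℂ) {m : ℕ} (x : Fin m → ℂ) (ω : Wedge) : ℂ :=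
  tau S ω (t + ∑ a, miwa (x a))

/-- The operator `(I + x₁ S) ⋯ (I + x_m S) E(t)`. -/
def shiftedFlow (S : H →L[ℂ] H) (t : ℕ+ → ℂ) {m : ℕ} (x : Fin m → ℂ) : H →L[ℂ] H :=
  (List.ofFn fun a => 1 + x a • S).prod * flow S t

/-- The extension of `shiftedTau` to arbitrary `x`: the coordinate at the ground state of the image of
`ω` under `(I + x₁ S) ⋯ (I + x_m S) E(t)`. -/
def shiftedTauExt (S : H →L[ℂ] H) (t : ℕ+ → ℂ) {m : ℕ} (x : Fin m → ℂ) (ω : Wedge) : ℂ :=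
  hatCoord (shiftedFlow S t x) ω ground

/-! ### Finite Grassmann cones and Grassmann cone preserving maps -/

/-- The Vandermonde determinant `Δ(x₁, …, x_m) = det (x_i ^ (j - 1))`. -/
def vanDet {m : ℕ} (x : Fin m → ℂ) : ℂ := (Matrix.vandermonde x).det

/-- The Grassmann cone `Γ^{k,n}` of decomposable elements `v₁ ∧ ⋯ ∧ v_k` of `⋀^k ℂⁿ`. -/
def grassmannCone (k n : ℕ) : Set (⋀[ℂ]^k (Fin n → ℂ)) :=
  Set.range (exteriorPower.ιMulti ℂ k (M := Fin n → ℂ))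

/-- The element of `⋀^k ℂⁿ` with coordinates `c I` with respect to the basis
`e_I = e_{i₁} ∧ ⋯ ∧ e_{i_k}`, `i₁ < ⋯ < i_k`. -/
def ofPlucker {k n : ℕ} (c : (Fin k ↪o Fin n) → ℂ) : ⋀[ℂ]^k (Fin n → ℂ) :=
  ∑ I : Fin k ↪o Fin n,
    c I • exteriorPower.ιMulti ℂ k (fun a => (Pi.single (I a) 1 : Fin n → ℂ))

/-- The map `⋀ → ⋀^k ℂⁿ` for which the coordinate of the image of `ω` at `i₁ < ⋯ < i_k` is
`Δ(λ_{i₁}, …, λ_{i_k}) F(λ_{i₁}, …, λ_{i_k}; ω)`. -/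
def vandermondeMap {k n : ℕ} (lam : Fin n → ℂ) (F : (Fin k → ℂ) → Wedge → ℂ) (ω : Wedge) :
    ⋀[ℂ]^k (Fin n → ℂ) :=
  ofPlucker fun I => vanDet (fun a => lam (I a)) * F (fun a => lam (I a)) ω

/-- The map `L̂_{k,n}`. -/
def Lhat (k n : ℕ) (S : H →L[ℂ] H) (t : ℕ+ → ℂ) (lam : Fin n → ℂ) (ω : Wedge) :
    ⋀[ℂ]^k (Fin n → ℂ) :=
  vandermondeMap lam (fun x => shiftedTau S t x) ω

/-- The map `L̂_{k,n}` with `shiftedTau` extended to arbitrary parameters. -/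
def LhatExt (k n : ℕ) (S : H →L[ℂ] H) (t : ℕ+ → ℂ) (lam : Fin n → ℂ) (ω : Wedge) :
    ⋀[ℂ]^k (Fin n → ℂ) :=
  vandermondeMap lam (fun x => shiftedTauExt S t x) ω

/-- `L` is a Grassmann cone preserving map: it is linear and maps `Γ` into `Γ^{k,n}`. -/
def IsGCP {k n : ℕ} (L : Wedge → ⋀[ℂ]^k (Fin n → ℂ)) : Prop :=
  IsLinearMap ℂ L ∧ ∀ ω ∈ satoCone, L ω ∈ grassmannCone k n

/-- The Plücker relations for `Γ^{k,n}`, for coordinates given as a function `p` of tuples of indices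
of length `k = (k - 1) + 1`: for all indices `i₁, …, i_{k-1}` and `j₁, …, j_{k+1}`,
`∑ₗ (-1)ˡ p(i₁, …, i_{k-1}, jₗ) p(j₁, …, jₗ₋₁, jₗ₊₁, …, j_{k+1}) = 0`. -/
def PluckerRelations (k n : ℕ) (p : ∀ {m : ℕ}, (Fin m → Fin n) → ℂ) : Prop :=
  ∀ (i : Fin (k - 1) → Fin n) (j : Fin (k + 1) → Fin n),
    ∑ l : Fin (k + 1), (-1 : ℂ) ^ (l : ℕ) *
      p (Fin.snoc (α := fun _ => Fin n) i (j l)) * p (fun a : Fin k => j (l.succAbove a)) = 0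

end SatoKP

end

open SatoKP

/-! Let ω = v₀ ∧ v₁ ∧ ⋯ lie in Γ and let P be the projection on the coordinates 0, …, m − 1. For
large m every operator in play is unipotent lower triangular from column m on, so Cauchy–Binet turns
the shifted τ into the determinant of the columns P p(S) w_b, b < m, with w_b = E(t) v_b and p = ∏
(1 + x_i X) (`hatCoord_ground_eq_det`). At admissible Miwa shifts this p(S) is an exponential,
because exp ∑ -(-x)ⁱ/i Sⁱ = 1 + x S; part (1) is thereby a case of part (2).

The rank hypothesis enters as P S = A P + u ⊗ φ, where A is the block of S in the rows and columns
0, …, m − 1 (`firstCoords_intertwine`). Hence P p(S) differs from p(A) P by k terms of rank at most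
one, and a block elimination shows that Δ(x) det(P p(S) w) is the determinant of a square matrix
(g(x₁) | ⋯ | g(x_k) | W) of size k + m. Here W does not involve x, and g(x) has the entries det(1 +
xA) xʲ above and -xᵏ adj(1 + xA) u below (`det_bordered`).

As W is fixed, this determinant equals det(B g(x₁) | ⋯ | B g(x_k)) for a single matrix B
(`exists_det_fromCols_eq`). So the numbers π̂ are the maximal minors of the k × n matrix with
columns B g(λ_r), which gives both decomposability and the Plücker relations. -/

noncomputable section

namespace SatoKP

/-! ### Polynomials in S and the bordered determinant -/

section LinearAlgebra

open Polynomial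

theorem coeff_divX_iterate (p : ℂ[X]) (j n : ℕ) : (divX^[j] p).coeff n = p.coeff (n + j) := by
  induction j generalizing n with
  | zero => simp
  | succ j ih => rw [Function.iterate_succ_apply', coeff_divX, ih]; congr 1; omega

theorem divX_iterate_eq_zero {p : ℂ[X]} {j : ℕ} (h : p.natDegree < j) : divX^[j] p = 0 := by
  ext n
  rw [coeff_divX_iterate, coeff_zero, coeff_eq_zero_of_natDegree_lt (by omega)]

theorem divX_iterate_eq (p : ℂ[X]) (j : ℕ) :
    divX^[j] p = X * divX^[j + 1] p + C (p.coeff j) := by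
  conv_lhs => rw [← X_mul_divX_add (divX^[j] p)]
  rw [Function.iterate_succ_apply', coeff_divX_iterate, zero_add]

/-- If `P S = A P + u ⊗ φ`, then `P p(S) = p(A) P + ∑ⱼ q_j(A) u ⊗ φ Sʲ`, where `q_j` is the quotient
of `p` by `X ^ (j + 1)`. -/
theorem map_aeval_intertwine {V : Type*} [AddCommGroup V] [Module ℂ V] {m : ℕ}
    (S : Module.End ℂ V) (P : V →ₗ[ℂ] (Fin m → ℂ)) (A : Matrix (Fin m) (Fin m) ℂ)
    (u : Fin m → ℂ) (φ : V →ₗ[ℂ] ℂ)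
    (h : ∀ w, P (S w) = A.mulVec (P w) + φ w • u) (k : ℕ) (p : ℂ[X])
    (hp : p.natDegree ≤ k) (w : V) :
    P (aeval S p w) = (aeval A p).mulVec (P w) +
      ∑ j ∈ Finset.range k, φ ((S ^ j) w) • (aeval A (divX^[j + 1] p)).mulVec u := by
  -- Horner's scheme: with p = X q + p(0), the relation for S is applied once, to the vector q(S) w.
  induction k generalizing p with
  | zero =>
    obtain ⟨c, rfl⟩ := natDegree_eq_zero.mp (Nat.le_zero.mp hp)
    simp [Algebra.algebraMap_eq_smul_one, Matrix.smul_mulVec]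
  | succ k ih =>
    have hq : p.divX.natDegree ≤ k := by
      rw [natDegree_divX_eq_natDegree_tsub_one]; omega
    have hpq : p = X * p.divX + C (p.coeff 0) := (X_mul_divX_add p).symm
    generalize hqd : p.divX = q at hq hpq
    have e1 : ∀ j, divX^[j + 1] p = divX^[j] q := fun j => by
      rw [Function.iterate_succ_apply, hqd]
    have e2 : φ (aeval S q w) = ∑ j ∈ Finset.range (k + 1), φ ((S ^ j) w) * q.coeff j := by
      rw [aeval_eq_sum_range' (Nat.lt_succ_of_le hq)]
      simp [mul_comm]
    have e3 : ∀ j, (aeval A (divX^[j] q)).mulVec u =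
        A.mulVec ((aeval A (divX^[j + 1] q)).mulVec u) + q.coeff j • u := fun j => by
      conv_lhs => rw [divX_iterate_eq]
      simp [Matrix.add_mulVec, Algebra.algebraMap_eq_smul_one, Matrix.smul_mulVec]
    have e4 : (aeval A p).mulVec (P w) =
        A.mulVec ((aeval A q).mulVec (P w)) + p.coeff 0 • P w := by
      conv_lhs => rw [hpq]
      simp [Matrix.add_mulVec, Algebra.algebraMap_eq_smul_one, Matrix.smul_mulVec]
    have e5 : P (aeval S p w) = P (S (aeval S q w)) + p.coeff 0 • P w := by
      conv_lhs => rw [hpq]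
      simp [Algebra.algebraMap_eq_smul_one]
    have e6 : ∑ j ∈ Finset.range (k + 1),
          φ ((S ^ j) w) • A.mulVec ((aeval A (divX^[j + 1] q)).mulVec u) =
        A.mulVec (∑ j ∈ Finset.range k, φ ((S ^ j) w) • (aeval A (divX^[j + 1] q)).mulVec u) := by
      rw [Finset.sum_range_succ, divX_iterate_eq_zero (Nat.lt_succ_of_le hq), Matrix.mulVec_sum]
      simp only [map_zero, Matrix.zero_mulVec, Matrix.mulVec_zero, smul_zero, add_zero,
        Matrix.mulVec_smul]
    rw [e5, h, ih q hq, e4]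
    have e7 : ∀ j ∈ Finset.range (k + 1), φ ((S ^ j) w) • (aeval A (divX^[j + 1] p)).mulVec u =
        φ ((S ^ j) w) • A.mulVec ((aeval A (divX^[j + 1] q)).mulVec u) +
          φ ((S ^ j) w) • q.coeff j • u := fun j _ => by rw [e1, e3, smul_add]
    rw [Finset.sum_congr rfl e7, Finset.sum_add_distrib, e6, e2, Matrix.mulVec_add, Finset.sum_smul]
    simp_rw [smul_smul]
    abel

/-- `∑ⱼ (-1)ʲ λᵏ⁻¹⁻ʲ q_j = λᵏ r` for `p = (1 + λ X) r` with `deg r < k`, where `q_j` is the quotient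
of `p` by `X ^ (j + 1)`. -/
theorem sum_divX_iterate (k : ℕ) (x : ℂ) (r : ℂ[X]) (hr : r.natDegree < k) :
    ∑ j ∈ Finset.range k, ((-1) ^ j * x ^ (k - 1 - j)) • divX^[j + 1] ((1 + C x * X) * r) =
      x ^ k • r := by
  -- Dividing (1 + xX) r by X ^ (j + 1) gives `divX^[j + 1] r` plus x times `divX^[j] r`, so the
  -- alternating sum telescopes.
  have key : ∀ j ∈ Finset.range k,
      ((-1) ^ j * x ^ (k - 1 - j)) • divX^[j + 1] ((1 + C x * X) * r) =
        ((-1) ^ j * x ^ (k - j)) • divX^[j] r -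
          ((-1) ^ (j + 1) * x ^ (k - (j + 1))) • divX^[j + 1] r := fun j hj => by
    have hj' := Finset.mem_range.mp hj
    have e : k - j = k - 1 - j + 1 := by omega
    have e' : k - (j + 1) = k - 1 - j := by omega
    rw [e, e']
    ext n
    simp only [coeff_smul, coeff_sub, coeff_divX_iterate, add_mul, one_mul, coeff_add, mul_assoc,
      coeff_C_mul, ← add_assoc, coeff_X_mul, smul_eq_mul]
    ring
  rw [Finset.sum_congr rfl key, Finset.sum_range_sub', divX_iterate_eq_zero hr]
  simp

/-- Block elimination: multiplication on the left by the block matrix (1 0; T p(A)) clears the lower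
left block and turns the lower right one into P p(S) w. Both det p(A) and the determinant of the
upper left block contain the factor ∏ det(1 + x_i A), which cancels when it is nonzero. -/
theorem det_bordered_of_ne_zero {V : Type*} [AddCommGroup V] [Module ℂ V] {m : ℕ}
    (S : Module.End ℂ V) (P : V →ₗ[ℂ] (Fin m → ℂ)) (A : Matrix (Fin m) (Fin m) ℂ)
    (u : Fin m → ℂ) (φ : V →ₗ[ℂ] ℂ)
    (h : ∀ w, P (S w) = A.mulVec (P w) + φ w • u) {k : ℕ} (x : Fin k → ℂ)
    (hx : ∀ i, (1 + x i • A).det ≠ 0) (w : Fin m → V) :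
    (Matrix.fromBlocks (Matrix.of fun j i : Fin k => (1 + x i • A).det * x i ^ (j : ℕ))
      (Matrix.of fun (j : Fin k) b =>
        (-1) ^ (k - 1 - (j : ℕ)) * φ ((S ^ (k - 1 - (j : ℕ))) (w b)))
      (Matrix.of fun a (i : Fin k) => -(x i ^ k * (1 + x i • A).adjugate.mulVec u a))
      (Matrix.of fun a b => P (w b) a)).det =
    vanDet x * (Matrix.of fun a b => P ((List.ofFn fun i => 1 + x i • S).prod (w b)) a).det := by
  set p : ℂ[X] := ∏ i, (1 + C (x i) * X) with hp
  have hdeg1 : ∀ i, (1 + C (x i) * X : ℂ[X]).natDegree ≤ 1 := fun i => by compute_degree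
  have hdeg : p.natDegree ≤ k := by
    refine (natDegree_prod_le _ _).trans ((Finset.sum_le_sum fun i _ => hdeg1 i).trans ?_)
    simp
  have hS : (List.ofFn fun i => 1 + x i • S).prod = aeval S p := by
    rw [hp, ← List.prod_ofFn, map_list_prod, List.map_ofFn]
    congr 2
    ext1 i
    simp [Algebra.smul_def]
  have hA : (aeval A p).det = ∏ i, (1 + x i • A).det := by
    rw [hp, ← List.prod_ofFn, map_list_prod, List.map_ofFn, ← Matrix.coe_detMonoidHom,
      map_list_prod, List.map_ofFn, List.prod_ofFn]
    refine Finset.prod_congr rfl fun i _ => ?_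
    simp [Algebra.smul_def]
  -- The index is reversed, j ↦ k - 1 - j, so that T meets the row x_i ^ j with the weights of
  -- `sum_divX_iterate`.
  set T : Matrix (Fin m) (Fin k) ℂ := Matrix.of fun a j =>
    (-1) ^ (k - 1 - (j : ℕ)) * (aeval A (divX^[k - 1 - (j : ℕ) + 1] p)).mulVec u a with hT
  have key := congrArg Matrix.det (Matrix.fromBlocks_multiply (1 : Matrix (Fin k) (Fin k) ℂ) 0 T
    (aeval A p)
    (Matrix.of fun j i : Fin k => (1 + x i • A).det * x i ^ (j : ℕ))
      (Matrix.of fun (j : Fin k) b =>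
        (-1) ^ (k - 1 - (j : ℕ)) * φ ((S ^ (k - 1 - (j : ℕ))) (w b)))
      (Matrix.of fun a (i : Fin k) => -(x i ^ k * (1 + x i • A).adjugate.mulVec u a))
      (Matrix.of fun a b => P (w b) a))
  rw [Matrix.det_mul, Matrix.det_fromBlocks_zero₁₂, Matrix.det_one, one_mul] at key
  -- With r = p / (1 + x_i X), p(A) adj(1 + x_i A) = det(1 + x_i A) r(A), and T contributes the same
  -- vector with the opposite sign.
  have b1 : (T * Matrix.of fun j i : Fin k => (1 + x i • A).det * x i ^ (j : ℕ)) +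
      aeval A p * Matrix.of (fun a (i : Fin k) =>
        -(x i ^ k * (1 + x i • A).adjugate.mulVec u a)) = 0 := by
    ext a i
    set r : ℂ[X] := ∏ l ∈ Finset.univ.erase i, (1 + C (x l) * X) with hr
    have hpr : p = (1 + C (x i) * X) * r :=
      (Finset.mul_prod_erase _ _ (Finset.mem_univ i)).symm
    have hk : 0 < k := i.pos
    have hrk : r.natDegree < k := by
      refine ((natDegree_prod_le _ _).trans (Finset.sum_le_sum fun i _ => hdeg1 i)).trans_lt ?_
      simp [hk]
    have f1 : aeval A p * (1 + x i • A).adjugate = (1 + x i • A).det • aeval A r := by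
      have : aeval A (1 + C (x i) * X) = 1 + x i • A := by simp [Algebra.smul_def]
      rw [hpr, mul_comm, map_mul, this, mul_assoc, Matrix.mul_adjugate]
      simp
    have f2 := congrArg (fun q => (aeval A q).mulVec u a) (sum_divX_iterate k (x i) r hrk)
    simp only [← hpr, map_sum, map_smul, Matrix.smul_mulVec, Matrix.sum_mulVec, Finset.sum_apply,
      Pi.smul_apply, smul_eq_mul] at f2
    have f3 : ∑ j, aeval A p a j * -(x i ^ k * (1 + x i • A).adjugate.mulVec u j) =
        -(x i ^ k * ((1 + x i • A).det * (aeval A r).mulVec u a)) := by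
      have f4 := congrFun (congrArg (fun B => Matrix.mulVec B u) f1) a
      simp only [← Matrix.mulVec_mulVec, Matrix.smul_mulVec, Pi.smul_apply, smul_eq_mul] at f4
      rw [← f4, Matrix.mulVec, dotProduct, Finset.mul_sum, ← Finset.sum_neg_distrib]
      exact Finset.sum_congr rfl fun j _ => by ring
    simp only [Matrix.add_apply, Matrix.mul_apply, Matrix.of_apply, hT, Matrix.zero_apply]
    rw [f3, ← mul_left_comm, ← f2, ← Finset.sum_range_reflect, Finset.mul_sum,
      ← Fin.sum_univ_eq_sum_range (fun j => (1 + x i • A).det * ((-1) ^ (k - 1 - j) *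
        x i ^ (k - 1 - (k - 1 - j)) * (aeval A (divX^[k - 1 - j + 1] p)).mulVec u a)),
      ← sub_eq_add_neg, ← Finset.sum_sub_distrib]
    refine Finset.sum_eq_zero fun j _ => ?_
    rw [show k - 1 - (k - 1 - (j : ℕ)) = j by omega]
    ring
  have b2 : (T * Matrix.of fun (j : Fin k) b =>
        (-1) ^ (k - 1 - (j : ℕ)) * φ ((S ^ (k - 1 - (j : ℕ))) (w b))) +
      aeval A p * (Matrix.of fun a b => P (w b) a) =
      Matrix.of fun a b => P (aeval S p (w b)) a := by
    ext a b
    have f := congrFun (map_aeval_intertwine S P A u φ h k p hdeg (w b)) a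
    rw [Matrix.of_apply, f, ← Finset.sum_range_reflect]
    simp only [Matrix.add_apply, Matrix.mul_apply, Matrix.of_apply, hT, Pi.add_apply,
      Finset.sum_apply, Pi.smul_apply, smul_eq_mul]
    rw [← Fin.sum_univ_eq_sum_range (fun j => φ ((S ^ (k - 1 - j)) (w b)) *
      (aeval A (divX^[k - 1 - j + 1] p)).mulVec u a), add_comm]
    congr 1
    refine Finset.sum_congr rfl fun j _ => ?_
    have hs : ((-1 : ℂ) ^ (k - 1 - (j : ℕ))) * (-1) ^ (k - 1 - (j : ℕ)) = 1 := by
      rw [← mul_pow]; simp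
    linear_combination
      (aeval A (divX^[k - 1 - (j : ℕ) + 1] p)).mulVec u a * φ ((S ^ (k - 1 - (j : ℕ))) (w b)) * hs
  rw [b1, b2, Matrix.zero_mul, Matrix.zero_mul, Matrix.one_mul, Matrix.one_mul, add_zero, add_zero,
    Matrix.det_fromBlocks_zero₂₁, hA] at key
  rw [hS]
  have hG : (Matrix.of fun j i : Fin k => (1 + x i • A).det * x i ^ (j : ℕ)).det =
      (∏ i, (1 + x i • A).det) * vanDet x := by
    rw [← Matrix.det_transpose, vanDet, ← Matrix.det_mul_column]
    rfl
  rw [hG, mul_assoc] at key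
  exact mul_left_cancel₀ (Finset.prod_ne_zero_iff.mpr fun i _ => hx i) key

/-- Each determinant is a polynomial in s with value 1 at s = 0, so only finitely many s are
excluded. -/
theorem dense_det_one_add_smul_ne_zero {m k : ℕ} (A : Matrix (Fin m) (Fin m) ℂ) (x : Fin k → ℂ) :
    Dense {s : ℂ | ∀ i, (1 + (s * x i) • A).det ≠ 0} := by
  set q : Fin k → ℂ[X] := fun i => (1 + (X : ℂ[X]) • (x i • A).map C).det with hq
  have he : ∀ s i, (q i).eval s = (1 + (s * x i) • A).det := fun s i => by
    rw [hq, ← coe_evalRingHom, RingHom.map_det]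
    congr 1
    ext a b
    by_cases hab : a = b <;> simp [hab, mul_assoc]
  have hfin : {s : ℂ | (∏ i, q i).IsRoot s}.Finite := by
    refine finite_setOfPred_isRoot (Finset.prod_ne_zero_iff.mpr fun i _ h0 => ?_)
    have := he 0 i
    simp [h0] at this
  refine (hfin.countable.dense_compl ℂ).mono ?_
  intro s hs i h0
  apply hs
  rw [Set.mem_ofPred_eq, IsRoot, eval_prod]
  exact Finset.prod_eq_zero (Finset.mem_univ i) ((he s i).trans h0)

/-- The Vandermonde multiple of the minor of `(1 + x₁ S) ⋯ (1 + x_k S)` is a bordered determinant,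
in which the `i`-th bordering column depends only on `x i`. -/
theorem det_bordered {V : Type*} [NormedAddCommGroup V] [NormedSpace ℂ V] {m : ℕ}
    (S : V →L[ℂ] V) (P : V →L[ℂ] (Fin m → ℂ)) (A : Matrix (Fin m) (Fin m) ℂ)
    (u : Fin m → ℂ) (φ : V →ₗ[ℂ] ℂ)
    (h : ∀ w, P (S w) = A.mulVec (P w) + φ w • u) {k : ℕ} (x : Fin k → ℂ) (w : Fin m → V) :
    (Matrix.fromBlocks (Matrix.of fun j i : Fin k => (1 + x i • A).det * x i ^ (j : ℕ))
      (Matrix.of fun (j : Fin k) b =>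
        (-1) ^ (k - 1 - (j : ℕ)) * φ ((S ^ (k - 1 - (j : ℕ))) (w b)))
      (Matrix.of fun a (i : Fin k) => -(x i ^ k * (1 + x i • A).adjugate.mulVec u a))
      (Matrix.of fun a b => P (w b) a)).det =
    vanDet x * (Matrix.of fun a b => P ((List.ofFn fun i => 1 + x i • S).prod (w b)) a).det := by
  -- Removal of the nonvanishing condition: x is scaled by s, both sides are continuous in s and
  -- agree on a dense set, and s = 1 is the claim.
  set F : ℂ → ℂ := fun s => (Matrix.fromBlocks
    (Matrix.of fun j i : Fin k => (1 + (s * x i) • A).det * (s * x i) ^ (j : ℕ))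
    (Matrix.of fun (j : Fin k) b =>
        (-1) ^ (k - 1 - (j : ℕ)) * φ ((S ^ (k - 1 - (j : ℕ))) (w b)))
    (Matrix.of fun a (i : Fin k) => -((s * x i) ^ k * (1 + (s * x i) • A).adjugate.mulVec u a))
    (Matrix.of fun a b => P (w b) a)).det with hF
  set G : ℂ → ℂ := fun s => vanDet (fun i => s * x i) *
    (Matrix.of fun a b => P ((List.ofFn fun i => 1 + (s * x i) • S).prod (w b)) a).det with hG
  suffices hFG : F = G by simpa [hF, hG] using congrFun hFG 1
  have hFc : Continuous F := by
    refine Continuous.matrix_det (Continuous.matrix_fromBlocks ?_ ?_ ?_ ?_)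
    · refine continuous_matrix fun j i => ?_
      exact (Continuous.matrix_det (by fun_prop)).mul (by fun_prop)
    · exact continuous_const
    · refine continuous_matrix fun a i => ?_
      have : Continuous fun s : ℂ => (1 + (s * x i) • A).adjugate.mulVec u :=
        Continuous.matrix_mulVec (Continuous.matrix_adjugate (by fun_prop)) continuous_const
      have := (continuous_apply a).comp this
      exact ((by fun_prop : Continuous fun s : ℂ => (s * x i) ^ k).mul this).neg
    · exact continuous_const
  have hGc : Continuous G := by
    refine Continuous.mul (Continuous.matrix_det ?_) (Continuous.matrix_det ?_)
    · refine continuous_matrix fun i j => ?_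
      simp only [Matrix.vandermonde_apply]
      fun_prop
    · refine continuous_matrix fun a b => ?_
      have : Continuous fun s : ℂ => (List.ofFn fun i => 1 + (s * x i) • S).prod := by
        simp_rw [List.ofFn_eq_map]
        exact continuous_list_prod _ fun i _ => by fun_prop
      exact (continuous_apply a).comp (P.continuous.comp (this.clm_apply continuous_const))
  refine hFc.ext_on (dense_det_one_add_smul_ne_zero A x) hGc fun s hs => ?_
  have e := det_bordered_of_ne_zero (S : Module.End ℂ V) (P : V →ₗ[ℂ] (Fin m → ℂ)) A u φ h
    (fun i => s * x i) hs w
  have e1 : ∀ v, (List.ofFn fun i => 1 + (s * x i) • (S : Module.End ℂ V)).prod v =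
      (List.ofFn fun i => 1 + (s * x i) • S).prod v := fun v => by
    have := map_list_prod (ContinuousLinearMap.toLinearMapRingHom (R₁ := ℂ) (M₁ := V))
      (List.ofFn fun i => 1 + (s * x i) • S)
    rw [List.map_ofFn] at this
    exact (congrArg (fun f : Module.End ℂ V => f v) this).symm
  have e2 : ∀ (j : ℕ) v, ((S : Module.End ℂ V) ^ j) v = (S ^ j) v := fun j v =>
    (congrArg (fun f : Module.End ℂ V => f v)
      (map_pow (ContinuousLinearMap.toLinearMapRingHom (R₁ := ℂ) (M₁ := V)) S j)).symm
  simp only [e1, e2, ContinuousLinearMap.coe_coe] at e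
  exact e

/-! ### Bordered minors, decomposable elements and Plücker relations -/

/-- A nonempty minor of the columns `g`, bordered by fixed columns, is a minor of a fixed linear
image of the columns `g`. -/
theorem exists_det_fromCols_eq {k m : ℕ} (hk : 0 < k) (W : Matrix (Fin k ⊕ Fin m) (Fin m) ℂ) :
    ∃ B : Matrix (Fin k) (Fin k ⊕ Fin m) ℂ, ∀ g : Matrix (Fin k ⊕ Fin m) (Fin k) ℂ,
      (Matrix.fromCols g W).det = (B * g).det := by
  by_cases h : ∀ g : Matrix (Fin k ⊕ Fin m) (Fin k) ℂ, (Matrix.fromCols g W).det = 0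
  -- The zero matrix has determinant 0 only because k > 0.
  · refine ⟨0, fun g => ?_⟩
    have : Nonempty (Fin k) := ⟨⟨0, hk⟩⟩
    rw [h, Matrix.zero_mul, Matrix.det_zero]
  · push Not at h
    obtain ⟨g₀, h₀⟩ := h
    set U := Matrix.fromCols g₀ W with hU
    have hu : IsUnit U.det := isUnit_iff_ne_zero.mpr h₀
    -- In the basis formed by the columns of U, the border W consists of the last m unit vectors, so
    -- only the first k rows of U⁻¹ g matter.
    have hW : U⁻¹ * W = Matrix.fromRows 0 1 := by
      have e1 : Matrix.fromCols (U⁻¹ * g₀) (U⁻¹ * W) = 1 := by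
        rw [← Matrix.mul_fromCols, Matrix.nonsing_inv_mul _ hu]
      rw [← Matrix.fromBlocks_one, ← Matrix.fromCols_fromRows_eq_fromBlocks] at e1
      exact (Matrix.fromCols_inj.eq_iff.mp e1).2
    -- D absorbs the factor det U by scaling one row.
    set D : Matrix (Fin k) (Fin k) ℂ := Matrix.diagonal (Function.update 1 ⟨0, hk⟩ U.det) with hD
    have hDd : D.det = U.det := by
      rw [hD, Matrix.det_diagonal, Finset.prod_update_of_mem (Finset.mem_univ _)]
      simp
    refine ⟨D * U⁻¹.toRows₁, fun g => ?_⟩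
    rw [Matrix.mul_assoc, Matrix.det_mul, hDd]
    have e2 : Matrix.fromCols g W = U * Matrix.fromCols (U⁻¹ * g) (U⁻¹ * W) := by
      rw [← Matrix.mul_fromCols, Matrix.mul_nonsing_inv_cancel_left _ _ hu]
    rw [e2, Matrix.det_mul, hW, ← Matrix.fromRows_toRows (U⁻¹ * g),
      Matrix.fromCols_fromRows_eq_fromBlocks, Matrix.det_fromBlocks_zero₁₂, Matrix.det_one, mul_one]
    rfl

/-- The coordinates of a decomposable element are its pairings with the dual basis, which are
minors. -/
theorem ofPlucker_det {k n : ℕ} (B : Matrix (Fin k) (Fin n) ℂ) :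
    ofPlucker (fun I => (B.submatrix id I).det) = exteriorPower.ιMulti ℂ k (fun a => B a) := by
  set b := (Pi.basisFun ℂ (Fin n)).exteriorPower k with hb
  rw [← b.sum_repr (exteriorPower.ιMulti ℂ k (fun a => B a)), ofPlucker,
    ← Equiv.sum_comp Set.powersetCard.ofFinEmbEquiv]
  refine Finset.sum_congr rfl fun I _ => ?_
  rw [hb, exteriorPower.basis_repr_apply, exteriorPower.ιMultiDual_apply_ιMulti,
    exteriorPower.basis_apply, exteriorPower.ιMulti_family]
  simp only [Equiv.symm_apply_apply]
  congr 2
  ext a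
  simp

/-- Expanding the first factor along its last column leaves, for each row a, the Laplace expansion
of a determinant in which row a of B occurs twice. -/
theorem pluckerRelations_det {k n : ℕ} (hk : 0 < k) (p : ∀ {m : ℕ}, (Fin m → Fin n) → ℂ)
    (B : Matrix (Fin k) (Fin n) ℂ)
    (hp : ∀ I : Fin k → Fin n, p I = (B.submatrix id I).det) : PluckerRelations k n p := by
  obtain ⟨k, rfl⟩ := Nat.exists_eq_succ_of_ne_zero hk.ne'
  intro i j
  change Fin k → Fin n at i
  change ∑ l : Fin (k + 1 + 1), (-1 : ℂ) ^ (l : ℕ) *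
      p (Fin.snoc (α := fun _ => Fin n) i (j l) : Fin (k + 1) → Fin n) *
        p (fun a : Fin (k + 1) => j (l.succAbove a)) = 0
  simp only [hp]
  have h0 : ∀ a : Fin (k + 1), ∑ l : Fin (k + 1 + 1),
      (-1 : ℂ) ^ (l : ℕ) * B a (j l) * (B.submatrix id fun a => j (l.succAbove a)).det = 0 := by
    intro a
    have e := Matrix.det_succ_row_zero
      (Matrix.of (Fin.cons (B a) (fun a' => B a') : Fin (k + 1 + 1) → Fin n → ℂ) |>.submatrix id j)
    rw [Matrix.det_zero_of_row_eq (i := 0) (j := a.succ) (Fin.succ_ne_zero a).symm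
      (by ext l; simp)] at e
    exact e.symm
  have h1 : ∀ l, (B.submatrix id (Fin.snoc (α := fun _ => Fin n) i (j l) : Fin (k + 1) → Fin n)).det
      = ∑ a : Fin (k + 1), (-1) ^ ((a : ℕ) + k) * B a (j l) *
        (B.submatrix a.succAbove i).det := by
    intro l
    rw [Matrix.det_succ_column _ (Fin.last k)]
    refine Finset.sum_congr rfl fun a _ => ?_
    simp only [Matrix.submatrix_apply, id, Fin.snoc_last, Fin.val_last, Matrix.submatrix_submatrix]
    congr 3
    ext b
    simp [Fin.succAbove_last]
  simp only [h1, Finset.mul_sum, Finset.sum_mul]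
  rw [Finset.sum_comm]
  refine Finset.sum_eq_zero fun a _ => ?_
  have := congrArg (fun z => (-1) ^ ((a : ℕ) + k) * (B.submatrix a.succAbove i).det * z) (h0 a)
  simp only [mul_zero, Finset.mul_sum] at this
  rw [← this]
  exact Finset.sum_congr rfl fun l _ => by ring

end LinearAlgebra

/-! ### The exponential of the logarithmic series, up to the boundary of convergence -/

section ExpLog

/-- The sum is affine in each c i, hence a convex combination of its values at c i ∈ {0, 1}, which
are the subset sums. -/
theorem norm_add_sum_smul_le {ι E : Type*} [NormedAddCommGroup E] [NormedSpace ℂ E] (a : ι → E)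
    {c : ι → ℝ} (hc : ∀ i, 0 ≤ c i ∧ c i ≤ 1) (t : Finset ι) {ε : ℝ} (y : E)
    (h : ∀ s ⊆ t, ‖y + ∑ i ∈ s, a i‖ ≤ ε) : ‖y + ∑ i ∈ t, (c i : ℂ) • a i‖ ≤ ε := by
  classical
  induction t using Finset.induction_on generalizing y with
  | empty => simpa using h ∅ subset_rfl
  | insert j t hj ih =>
    have h1 := ih y fun s hs => h s (hs.trans (Finset.subset_insert _ _))
    have h2 := ih (y + a j) fun s hs => by
      have := h (insert j s) (Finset.insert_subset_insert _ hs)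
      rwa [Finset.sum_insert fun hjs => hj (hs hjs), ← add_assoc] at this
    rw [Finset.sum_insert hj]
    set z := ∑ i ∈ t, (c i : ℂ) • a i
    have e : y + ((c j : ℂ) • a j + z) =
        ((1 - c j : ℝ) : ℂ) • (y + z) + (c j : ℂ) • (y + a j + z) := by
      push_cast
      module
    rw [e]
    refine (norm_add_le _ _).trans ?_
    rw [norm_smul, norm_smul, Complex.norm_real, Complex.norm_real, Real.norm_of_nonneg (hc j).1,
      Real.norm_of_nonneg (sub_nonneg.mpr (hc j).2)]
    have := mul_le_mul_of_nonneg_left h1 (sub_nonneg.mpr (hc j).2)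
    have := mul_le_mul_of_nonneg_left h2 (hc j).1
    linarith

/-- Abel's theorem for an unconditionally convergent series. -/
theorem tendsto_tsum_pow_smul {E : Type*} [NormedAddCommGroup E] [NormedSpace ℂ E] [CompleteSpace E]
    {a : ℕ → E}
    (ha : Summable a) (har : ∀ r : ℝ, 0 ≤ r → r < 1 → Summable fun n => (r : ℂ) ^ (n + 1) • a n) :
    Tendsto (fun r : ℝ => ∑' n, (r : ℂ) ^ (n + 1) • a n) (𝓝[<] 1) (𝓝 (∑' n, a n)) := by
  rw [Metric.tendsto_nhds]
  intro ε hε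
  -- Finite sums off s are small, and stay so with the weights 1 - r ^ (n + 1) ∈ [0, 1]; on s the
  -- weights tend to 0.
  obtain ⟨s, hs⟩ := summable_iff_vanishing_norm.mp ha (ε / 2) (half_pos hε)
  have hfin : Tendsto (fun r : ℝ => ‖∑ n ∈ s, (((1 - r ^ (n + 1) : ℝ)) : ℂ) • a n‖) (𝓝[<] 1)
      (𝓝 0) := by
    have : Continuous fun r : ℝ => ‖∑ n ∈ s, (((1 - r ^ (n + 1) : ℝ)) : ℂ) • a n‖ := by fun_prop
    have := (this.tendsto 1).mono_left (nhdsWithin_le_nhds (s := Set.Iio 1))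
    simpa using this
  have hr0 : ∀ᶠ r : ℝ in 𝓝[<] 1, 0 < r := nhdsWithin_le_nhds (lt_mem_nhds one_pos)
  filter_upwards [hfin.eventually_lt_const (half_pos hε), hr0, self_mem_nhdsWithin] with r h1 h0 hr
  have hc : ∀ n, 0 ≤ 1 - r ^ (n + 1) ∧ 1 - r ^ (n + 1) ≤ 1 := fun n =>
    ⟨sub_nonneg.mpr (pow_le_one₀ h0.le (le_of_lt hr)), sub_le_self _ (by positivity)⟩
  have hsum : HasSum (fun n => (((1 - r ^ (n + 1) : ℝ)) : ℂ) • a n)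
      (∑' n, a n - ∑' n, (r : ℂ) ^ (n + 1) • a n) := by
    convert ha.hasSum.sub (har r h0.le hr).hasSum using 2 with n
    push_cast
    module
  rw [dist_comm, dist_eq_norm]
  refine lt_of_le_of_lt (b := ‖∑ n ∈ s, (((1 - r ^ (n + 1) : ℝ)) : ℂ) • a n‖ + ε / 2) ?_
    (by linarith)
  refine le_of_tendsto hsum.norm (eventually_atTop.mpr ⟨s, fun t hst => ?_⟩)
  rw [← Finset.sum_sdiff hst, add_comm]
  refine (norm_add_le _ _).trans (add_le_add_right ?_ _)
  have := norm_add_sum_smul_le a hc (t \ s) (ε := ε / 2) 0 fun u hu => by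
    rw [zero_add]
    exact (hs u (Finset.disjoint_of_subset_left hu Finset.sdiff_disjoint)).le
  rwa [zero_add] at this

variable {𝔸 : Type*} [NormedRing 𝔸] [NormedAlgebra ℂ 𝔸] [CompleteSpace 𝔸]

/-- With G(z) the series, (1 + zT) G′(z) = T, so (1 + zT) exp(-G(z)) has derivative 0 on the unit
disc and equals its value 1 at z = 0. -/
theorem exp_tsum_pow_smul_of_norm_lt_one (T : 𝔸) {C : ℝ}
    (hC : ∀ n : ℕ, ‖T ^ (n + 1)‖ ≤ C * (n + 1)) {z : ℂ} (hz : ‖z‖ < 1) :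
    Summable (fun n : ℕ => z ^ (n + 1) • ((-1) ^ n / (n + 1) : ℂ) • T ^ (n + 1)) ∧
    NormedSpace.exp (∑' n : ℕ, z ^ (n + 1) • ((-1) ^ n / (n + 1) : ℂ) • T ^ (n + 1)) =
      1 + z • T := by
  let _ : NormedAlgebra ℚ 𝔸 := NormedAlgebra.restrictScalars ℚ ℂ 𝔸
  have hC0 : 0 ≤ C := by
    have := (norm_nonneg _).trans (hC 0)
    simpa using this
  set a : ℕ → 𝔸 := fun n => ((-1) ^ n / (n + 1) : ℂ) • T ^ (n + 1) with ha
  have hna : ∀ n, ‖a n‖ ≤ C := fun n => by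
    have hn : (0 : ℝ) < n + 1 := by positivity
    have e : ‖((-1) ^ n / (n + 1) : ℂ)‖ = 1 / (n + 1) := by
      rw [norm_div, norm_pow, norm_neg, norm_one, one_pow]
      congr 1
      exact_mod_cast Complex.norm_natCast (n + 1)
    rw [ha, norm_smul, e, one_div, inv_mul_le_iff₀ hn, mul_comm]
    exact hC n
  have hsum : ∀ z : ℂ, ‖z‖ < 1 → Summable fun n => z ^ (n + 1) • a n := fun z hz => by
    refine Summable.of_norm_bounded (g := fun n => ‖z‖ ^ (n + 1) * C) ?_ fun n => ?_
    · exact (((summable_geometric_of_lt_one (norm_nonneg z) hz).mul_left ‖z‖).mul_right C).congr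
        fun n => by rw [pow_succ']
    · rw [norm_smul, norm_pow]
      gcongr
      exact hna n
  refine ⟨hsum z hz, ?_⟩
  set G : ℂ → 𝔸 := fun z => ∑' n, z ^ (n + 1) • a n with hG
  have hGd : ∀ z : ℂ, ‖z‖ < 1 → ∃ D, HasDerivAt G D z ∧ (1 + z • T) * D = T := fun z hz => by
    obtain ⟨ρ, hρ, hρ1⟩ := exists_between hz
    have hρ0 : 0 ≤ ρ := (norm_nonneg z).trans hρ.le
    have hu : Summable fun n : ℕ => ρ ^ n * (C * (n + 1)) := by
      have h1 := summable_pow_mul_geometric_of_norm_lt_one 1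
        (show ‖ρ‖ < 1 by rwa [Real.norm_of_nonneg hρ0])
      have h2 := summable_geometric_of_lt_one hρ0 hρ1
      refine ((h1.add h2).mul_left C).congr fun n => ?_
      rw [pow_one]
      ring
    have hb : ∀ (n : ℕ) (y : ℂ), y ∈ Metric.ball (0 : ℂ) ρ →
        ‖(-y) ^ n • T ^ (n + 1)‖ ≤ ρ ^ n * (C * (n + 1)) := fun n y hy => by
      rw [norm_smul, norm_pow, norm_neg]
      have := mem_ball_zero_iff.mp hy
      gcongr
      exact hC n
    have hzm : z ∈ Metric.ball (0 : ℂ) ρ := mem_ball_zero_iff.mpr hρ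
    refine ⟨∑' n : ℕ, (-z) ^ n • T ^ (n + 1), ?_, ?_⟩
    · refine hasDerivAt_tsum_of_isPreconnected hu Metric.isOpen_ball
        (convex_ball (0 : ℂ) ρ).isPreconnected (fun n y _ => ?_) hb hzm (hsum z hz) hzm
      have := (hasDerivAt_pow (n + 1) y).smul_const (a n)
      convert this using 1
      have hn : (n : ℂ) + 1 ≠ 0 := by exact_mod_cast n.succ_ne_zero
      rw [ha, smul_smul, neg_pow]
      congr 1
      push_cast
      field_simp
    · have hs : Summable fun n : ℕ => (-z) ^ n • T ^ (n + 1) :=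
        Summable.of_norm_bounded hu fun n => hb n z hzm
      have e : z • T * ∑' n : ℕ, (-z) ^ n • T ^ (n + 1) =
          -∑' n : ℕ, (-z) ^ (n + 1) • T ^ (n + 1 + 1) := by
        rw [← hs.tsum_mul_left, ← tsum_neg]
        refine tsum_congr fun n => ?_
        rw [smul_mul_smul_comm, ← pow_succ', ← neg_smul]
        congr 1
        ring
      rw [add_mul, one_mul, e, hs.tsum_eq_zero_add]
      simp
  have hcomm : ∀ y z : ℂ, ‖y‖ < 1 → ‖z‖ < 1 → Commute (G y) (G z) := fun y z hy hz => by
    refine Commute.tsum_left _ fun n => Commute.tsum_right _ fun l => ?_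
    exact (((Commute.refl T).pow_pow _ _).smul_left _ |>.smul_right _ |>.smul_left _
      |>.smul_right _)
  set K : ℂ → 𝔸 := fun z => (1 + z • T) * NormedSpace.exp (-G z) with hK
  have hKd : ∀ z ∈ Metric.ball (0 : ℂ) 1, HasDerivAt K 0 z := fun z hz => by
    have hz := mem_ball_zero_iff.mp hz
    obtain ⟨D, hD, hDT⟩ := hGd z hz
    -- The values of G commute, so exp(-G y) = exp(-(G y - G z)) exp(-G z) and only the derivative
    -- of exp at 0 is needed.
    have h1 : HasDerivAt (fun y => NormedSpace.exp (-(G y - G z))) (-D) z := by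
      have := (hasFDerivAt_exp_zero (𝕂 := ℂ) (𝔸 := 𝔸)).comp_hasDerivAt_of_eq z
        (hD.sub_const (G z)).fun_neg (by simp)
      exact this
    have h2 : HasDerivAt (fun y => NormedSpace.exp (-G y)) (-D * NormedSpace.exp (-G z)) z := by
      refine (h1.mul_const (NormedSpace.exp (-G z))).congr_of_eventuallyEq ?_
      filter_upwards [Metric.isOpen_ball.mem_nhds (mem_ball_zero_iff.mpr hz)] with y hy
      rw [← NormedSpace.exp_add_of_commute]
      · congr 1; abel
      · exact ((hcomm y z (mem_ball_zero_iff.mp hy) hz).sub_left (Commute.refl _)).neg_left.neg_right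
    have h3 : HasDerivAt (fun y : ℂ => 1 + y • T) T z := by
      simpa using ((hasDerivAt_id z).smul_const T).const_add 1
    convert h3.fun_mul h2 using 1
    rw [neg_mul, mul_neg, ← mul_assoc, hDT, add_neg_cancel]
  have hK0 : K z = K 0 := by
    refine (convex_ball (0 : ℂ) 1).is_const_of_fderivWithin_eq_zero (𝕜 := ℂ)
      (fun y hy => (hKd y hy).differentiableAt.differentiableWithinAt) (fun y hy => ?_)
      (mem_ball_zero_iff.mpr hz) (Metric.mem_ball_self one_pos)
    rw [fderivWithin_of_isOpen Metric.isOpen_ball hy]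
    ext
    simp [(hKd y hy).hasFDerivAt.fderiv]
  have hG0 : G 0 = 0 := by simp [hG]
  simp only [hK, hG0, zero_smul, add_zero, neg_zero, NormedSpace.exp_zero, mul_one] at hK0
  have h := congrArg (· * NormedSpace.exp (G z)) hK0
  simp only [mul_assoc, one_mul] at h
  rw [← NormedSpace.exp_add_of_commute ((Commute.refl (G z)).neg_left), neg_add_cancel,
    NormedSpace.exp_zero, mul_one] at h
  exact h.symm

/-- The exponential of the logarithmic series of `1 + T`, whenever this series converges. -/
theorem exp_tsum_log_one_add (T : 𝔸)
    (h : Summable fun n : ℕ => ((-1) ^ n / (n + 1) : ℂ) • T ^ (n + 1)) :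
    NormedSpace.exp (∑' n : ℕ, ((-1) ^ n / (n + 1) : ℂ) • T ^ (n + 1)) = 1 + T := by
  let _ : NormedAlgebra ℚ 𝔸 := NormedAlgebra.restrictScalars ℚ ℂ 𝔸
  -- The terms of a convergent series are bounded, so the powers of T grow at most linearly; this
  -- gives the identity for rT with r < 1, and Abel's theorem lets r tend to 1.
  obtain ⟨C, hC⟩ := h.tendsto_atTop_zero.norm.bddAbove_range
  have hC' : ∀ n : ℕ, ‖T ^ (n + 1)‖ ≤ C * (n + 1) := fun n => by
    have hn : (0 : ℝ) < n + 1 := by positivity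
    have e : ‖((-1) ^ n / (n + 1) : ℂ)‖ = 1 / (n + 1) := by
      rw [norm_div, norm_pow, norm_neg, norm_one, one_pow]
      congr 1
      exact_mod_cast Complex.norm_natCast (n + 1)
    have := hC ⟨n, rfl⟩
    simp only [norm_smul, e, one_div] at this
    rwa [inv_mul_le_iff₀ hn, mul_comm] at this
  have hr : ∀ r : ℝ, 0 ≤ r → r < 1 → ‖(r : ℂ)‖ < 1 := fun r h0 h1 => by
    rwa [Complex.norm_real, Real.norm_of_nonneg h0]
  have h1 := (tendsto_tsum_pow_smul h fun r h0 h1 =>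
    (exp_tsum_pow_smul_of_norm_lt_one T hC' (hr r h0 h1)).1).exp
  have h2 : Tendsto (fun r : ℝ => 1 + (r : ℂ) • T) (𝓝[<] 1) (𝓝 (1 + T)) := by
    have : Continuous fun r : ℝ => 1 + (r : ℂ) • T := by fun_prop
    simpa using (this.tendsto 1).mono_left (nhdsWithin_le_nhds (s := Set.Iio 1))
  refine tendsto_nhds_unique h1 (h2.congr' ?_)
  have hr0 : ∀ᶠ r : ℝ in 𝓝[<] 1, 0 < r := nhdsWithin_le_nhds (lt_mem_nhds one_pos)
  filter_upwards [hr0, self_mem_nhdsWithin] with r h0 h1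
  exact (exp_tsum_pow_smul_of_norm_lt_one T hC' (hr r h0.le h1)).2.symm

end ExpLog

/-! ### The flow at Miwa shifted times -/

theorem exp_tsum_miwa (S : H →L[ℂ] H) (x : ℂ) (hx : TimeConverges S (miwa x)) :
    NormedSpace.exp (∑' i : ℕ+, miwa x i • S ^ (i : ℕ)) = 1 + x • S := by
  have e : ∀ n : ℕ, miwa x n.succPNat • S ^ (n.succPNat : ℕ) =
      ((-1) ^ n / (n + 1) : ℂ) • (x • S) ^ (n + 1) := fun n => by
    rw [miwa, Nat.succPNat_coe, Nat.succ_eq_add_one, smul_pow, smul_smul, neg_pow]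
    congr 1
    push_cast
    ring
  have h1 : Summable fun n : ℕ => miwa x n.succPNat • S ^ (n.succPNat : ℕ) :=
    (Equiv.pnatEquivNat.symm.summable_iff (f := fun i : ℕ+ => miwa x i • S ^ (i : ℕ))).mpr hx
  have h2 : ∑' i : ℕ+, miwa x i • S ^ (i : ℕ) =
      ∑' n : ℕ, miwa x n.succPNat • S ^ (n.succPNat : ℕ) :=
    (Equiv.pnatEquivNat.symm.tsum_eq (fun i : ℕ+ => miwa x i • S ^ (i : ℕ))).symm
  rw [h2]
  simp only [e] at h1 ⊢
  exact exp_tsum_log_one_add _ h1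

theorem commute_tsum_times (S : H →L[ℂ] H) (s t : ℕ+ → ℂ) :
    Commute (∑' i : ℕ+, s i • S ^ (i : ℕ)) (∑' i : ℕ+, t i • S ^ (i : ℕ)) :=
  Commute.tsum_left _ fun _ => Commute.tsum_right _ fun _ =>
    (((Commute.refl S).pow_pow _ _).smul_left _).smul_right _

theorem flow_miwa_add (S : H →L[ℂ] H) {t : ℕ+ → ℂ} (ht : TimeConverges S t) {x : ℂ}
    (hx : TimeConverges S (miwa x)) :
    TimeConverges S (miwa x + t) ∧ flow S (miwa x + t) = (1 + x • S) * flow S t := by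
  let _ : NormedAlgebra ℚ (H →L[ℂ] H) := NormedAlgebra.restrictScalars ℚ ℂ _
  have h := hx.add ht
  refine ⟨by simpa only [TimeConverges, Pi.add_apply, add_smul] using h, ?_⟩
  rw [flow, flow]
  simp only [Pi.add_apply, add_smul]
  rw [hx.tsum_add ht, NormedSpace.exp_add_of_commute (commute_tsum_times S _ _),
    exp_tsum_miwa S x hx]

/-- At admissible Miwa shifts, the shifted flow is the flow at the shifted times. -/
theorem flow_add_sum_miwa (S : H →L[ℂ] H) {t : ℕ+ → ℂ} (ht : TimeConverges S t) {m : ℕ}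
    (x : Fin m → ℂ) (hx : ∀ a, TimeConverges S (miwa (x a))) :
    TimeConverges S (t + ∑ a, miwa (x a)) ∧
      flow S (t + ∑ a, miwa (x a)) = shiftedFlow S t x := by
  induction m with
  | zero => simpa [shiftedFlow] using ht
  | succ m ih =>
    obtain ⟨h1, h2⟩ := ih (fun a => x a.succ) fun a => hx a.succ
    obtain ⟨h3, h4⟩ := flow_miwa_add S h1 (hx 0)
    rw [Fin.sum_univ_succ, add_left_comm]
    refine ⟨h3, h4.trans ?_⟩
    rw [h2, shiftedFlow, shiftedFlow, List.ofFn_succ, List.prod_cons, mul_assoc]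

/-! ### Cauchy–Binet for infinite sums -/

section CauchyBinet

theorem summable_prod_pi_and_tsum {ι : Type*} {m : ℕ} (g : Fin m → ι → ℂ)
    (hg : ∀ a, Summable fun i => ‖g a i‖) :
    (Summable fun f : Fin m → ι => ‖∏ a, g a (f a)‖) ∧
      ∑' f : Fin m → ι, ∏ a, g a (f a) = ∏ a, ∑' i, g a i := by
  induction m with
  | zero => exact ⟨(hasSum_fintype _).summable, by simp [tsum_fintype]⟩
  | succ m ih =>
    obtain ⟨h1, h2⟩ := ih (fun a => g a.succ) fun a => hg a.succ
    let c : ι × (Fin m → ι) ≃ (Fin (m + 1) → ι) := Fin.consEquiv fun _ => ι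
    have e : ∀ z : ι × (Fin m → ι), ∏ a, g a (c z a) =
        g 0 z.1 * ∏ a : Fin m, g a.succ (z.2 a) := fun z => by
      rw [Fin.prod_univ_succ]
      rfl
    constructor
    · rw [← c.summable_iff]
      refine ((hg 0).mul_norm h1).congr fun z => ?_
      rw [Function.comp_apply, e]
    · rw [← c.tsum_eq, Fin.prod_univ_succ, ← h2,
        tsum_mul_tsum_of_summable_norm (hg 0) h1]
      exact tsum_congr e

theorem hasSum_prod_pi {ι : Type*} {m : ℕ} (g : Fin m → ι → ℂ)
    (hg : ∀ a, Summable fun i => ‖g a i‖) :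
    HasSum (fun f : Fin m → ι => ∏ a, g a (f a)) (∏ a, ∑' i, g a i) := by
  obtain ⟨h1, h2⟩ := summable_prod_pi_and_tsum g hg
  exact h2 ▸ h1.of_norm.hasSum

theorem comp_perm_injective {ι : Type*} [LinearOrder ι] {m : ℕ} :
    Function.Injective fun z : (Fin m ↪o ι) × Equiv.Perm (Fin m) => fun a => z.1 (z.2 a) := by
  rintro ⟨I, ρ⟩ ⟨J, σ⟩ h
  have h' : ∀ a, I (ρ a) = J (σ a) := fun a => congrFun h a
  have hr : Set.range I = Set.range J := by
    rw [← ρ.surjective.range_comp I, ← σ.surjective.range_comp J]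
    exact congrArg Set.range h
  have hIJ : I = J := OrderEmbedding.range_inj.mp hr
  subst hIJ
  exact Prod.ext rfl (Equiv.ext fun a => I.injective (h' a))

theorem exists_comp_perm_eq {ι : Type*} [LinearOrder ι] {m : ℕ} {f : Fin m → ι}
    (hf : Function.Injective f) :
    ∃ z : (Fin m ↪o ι) × Equiv.Perm (Fin m), (fun a => z.1 (z.2 a)) = f := by
  have hs : StrictMono (f ∘ Tuple.sort f) :=
    (Tuple.monotone_sort f).strictMono_of_injective (hf.comp (Tuple.sort f).injective)
  refine ⟨⟨OrderEmbedding.ofStrictMono _ hs, (Tuple.sort f)⁻¹⟩, ?_⟩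
  ext a
  simp

/-- The Cauchy–Binet formula for a product of infinite matrices. -/
theorem hasSum_det_mul_det {ι : Type*} [LinearOrder ι] {m : ℕ} (α β : Fin m → ι → ℂ)
    (h : ∀ a b, Summable fun i => ‖α a i * β b i‖) :
    HasSum (fun f : Fin m ↪o ι =>
        (Matrix.of fun a b => β b (f a)).det * (Matrix.of fun a b => α a (f b)).det)
      (Matrix.of fun a b => ∑' i, α a i * β b i).det := by
  set F : (Fin m → ι) → ℂ := fun f =>
    (∏ a, α a (f a)) * (Matrix.of fun a b => β b (f a)).det with hF
  have h1 : HasSum F (Matrix.of fun a b => ∑' i, α a i * β b i).det := by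
    rw [← Matrix.det_transpose, Matrix.det_apply']
    have e : F = fun f => ∑ σ : Equiv.Perm (Fin m), ((Equiv.Perm.sign σ : ℤ) : ℂ) *
        ∏ a, (α a (f a) * β (σ a) (f a)) := by
      ext f
      simp only [hF]
      rw [← Matrix.det_transpose, Matrix.det_apply', Finset.mul_sum]
      refine Finset.sum_congr rfl fun σ _ => ?_
      rw [Finset.prod_mul_distrib]
      simp only [Matrix.transpose_apply, Matrix.of_apply]
      ring
    rw [e]
    exact hasSum_sum fun σ _ => (hasSum_prod_pi _ fun a => h a (σ a)).mul_left _
  -- A non-injective f yields two equal rows; an injective one is uniquely an increasing tuple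
  -- composed with a permutation.
  have h2 := (comp_perm_injective (ι := ι) (m := m)).hasSum_iff (f := F)
    (a := (Matrix.of fun a b => ∑' i, α a i * β b i).det) fun f hf => by
    have hf' : ¬ Function.Injective f := fun hi => hf (exists_comp_perm_eq hi)
    rw [Function.not_injective_iff] at hf'
    obtain ⟨a, b, hab, hne⟩ := hf'
    rw [hF]
    simp only
    rw [Matrix.det_zero_of_row_eq hne (by ext; simp [hab]), mul_zero]
  refine (h2.mpr h1).prod_fiberwise fun I => ?_
  convert hasSum_fintype _ using 1
  have e : ∀ ρ : Equiv.Perm (Fin m), (Matrix.of fun a b => β b (I (ρ a))).det =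
      ((Equiv.Perm.sign ρ : ℤ) : ℂ) * (Matrix.of fun a b => β b (I a)).det := fun ρ =>
    Matrix.det_permute ρ (Matrix.of fun a b => β b (I a))
  rw [← Matrix.det_transpose (Matrix.of fun a b => α a (I b)),
    Matrix.det_apply' (Matrix.transpose _), Finset.mul_sum]
  refine Finset.sum_congr rfl fun ρ _ => ?_
  simp only [Function.comp_apply, hF, e, Matrix.transpose_apply, Matrix.of_apply]
  ring

end CauchyBinet

/-! ### Matrix entries and strictly lower triangular operators -/

section Entries

theorem hasSum_smul_e (h : H) : HasSum (fun l : ℤ => h l • e l) h := by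
  have := lp.hasSum_single (p := 2) (by simp) h
  convert this using 2 with l
  rw [e, ← lp.single_smul, smul_eq_mul, mul_one]

/-- The coordinate functional on `H`. -/
def coordCLM (j : ℤ) : H →L[ℂ] ℂ := innerSL ℂ (e j)

theorem coordCLM_apply (j : ℤ) (h : H) : coordCLM j h = h j := by
  rw [coordCLM, innerSL_apply_apply, e, lp.inner_single_left]
  simp

theorem hasSum_entry_mul (M : H →L[ℂ] H) (h : H) (j : ℤ) :
    HasSum (fun l => entry M j l * h l) ((M h) j) := by
  have := ((hasSum_smul_e h).mapL M).mapL (coordCLM j)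
  rw [coordCLM_apply] at this
  convert this using 2 with l
  rw [map_smul, map_smul, coordCLM_apply, smul_eq_mul, mul_comm, entry]

theorem summable_norm_sq_of_memℓp {ι : Type*} {f : ι → ℂ} (hf : Memℓp f 2) :
    Summable fun i => ‖f i‖ ^ 2 := by
  have := hf.summable (by simp)
  simpa using this

/-- Row j of M is, up to conjugation, the vector M* e_j. -/
theorem summable_norm_sq_entry (M : H →L[ℂ] H) (j : ℤ) :
    Summable fun l => ‖entry M j l‖ ^ 2 := by
  refine (summable_norm_sq_of_memℓp (lp.memℓp (ContinuousLinearMap.adjoint M (e j)))).congr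
    fun l => ?_
  rw [← coordCLM_apply, coordCLM, innerSL_apply_apply, ContinuousLinearMap.adjoint_inner_right,
    ← inner_conj_symm, RCLike.norm_conj, ← innerSL_apply_apply, ← coordCLM, coordCLM_apply, entry]

theorem summable_norm_mul_of_sq {ι : Type*} {f g : ι → ℂ} (hf : Summable fun i => ‖f i‖ ^ 2)
    (hg : Summable fun i => ‖g i‖ ^ 2) : Summable fun i => ‖f i * g i‖ := by
  refine Summable.of_nonneg_of_le (fun i => norm_nonneg _) (fun i => ?_) (hf.add hg)
  rw [norm_mul]
  nlinarith [sq_nonneg (‖f i‖ - ‖g i‖), sq_nonneg ‖f i‖, sq_nonneg ‖g i‖]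

theorem e_apply (i j : ℤ) : (e i : H) j = if j = i then 1 else 0 := by
  rw [e, lp.single_apply]
  split_ifs with h <;> simp [h]

/-- The operators that are strictly lower triangular in the columns `i ≥ N`. -/
def strictLower (N : ℤ) : Submodule ℂ (H →L[ℂ] H) where
  carrier := {M | ∀ i : ℤ, N ≤ i → ∀ j : ℤ, j ≤ i → entry M j i = 0}
  zero_mem' := fun _ _ _ _ => rfl
  add_mem' := by
    intro A B hA hB i hi j hj
    have : entry (A + B) j i = entry A j i + entry B j i := rfl
    rw [this, hA i hi j hj, hB i hi j hj, add_zero]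
  smul_mem' := by
    intro c A hA i hi j hj
    have : entry (c • A) j i = c * entry A j i := rfl
    rw [this, hA i hi j hj, mul_zero]

/-- In ∑ A_{jl} B_{li} with j ≤ i, the second factor vanishes for l ≤ i and the first for l > i. -/
theorem mul_mem_strictLower {N : ℤ} {A B : H →L[ℂ] H} (hA : A ∈ strictLower N)
    (hB : B ∈ strictLower N) : A * B ∈ strictLower N := by
  intro i hi j hj
  have h := hasSum_entry_mul A (B (e i)) j
  refine h.unique ?_
  convert hasSum_zero with l
  by_cases hl : l ≤ i
  · rw [show (B (e i)) l = 0 from hB i hi l hl, mul_zero]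
  · rw [hA l (by omega) j (by omega), zero_mul]

theorem isClosed_strictLower (N : ℤ) : IsClosed (strictLower N : Set (H →L[ℂ] H)) := by
  have : (strictLower N : Set (H →L[ℂ] H)) =
      ⋂ (i : ℤ) (_ : N ≤ i) (j : ℤ) (_ : j ≤ i), {M | coordCLM j (M (e i)) = 0} := by
    ext M
    simp only [Set.mem_iInter, Set.mem_ofPred_eq, coordCLM_apply]
    rfl
  rw [this]
  refine isClosed_iInter fun i => isClosed_iInter fun _ => isClosed_iInter fun j =>
    isClosed_iInter fun _ => isClosed_eq ?_ continuous_const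
  fun_prop

theorem mem_strictLower_of_hasSum {N : ℤ} {ι : Type*} {f : ι → H →L[ℂ] H} {A : H →L[ℂ] H}
    (h : HasSum f A) (hf : ∀ i, f i ∈ strictLower N) : A ∈ strictLower N :=
  (isClosed_strictLower N).mem_of_tendsto h
    (Eventually.of_forall fun _ => Submodule.sum_mem _ fun i _ => hf i)

theorem pow_succ_mem_strictLower {N : ℤ} {A : H →L[ℂ] H} (hA : A ∈ strictLower N) (n : ℕ) :
    A ^ (n + 1) ∈ strictLower N := by
  induction n with
  | zero => simpa using hA
  | succ n ih => rw [pow_succ]; exact mul_mem_strictLower ih hA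

theorem exp_sub_one_mem_strictLower {N : ℤ} {A : H →L[ℂ] H} (hA : A ∈ strictLower N) :
    NormedSpace.exp A - 1 ∈ strictLower N := by
  have h := (hasSum_nat_add_iff' 1).mpr (NormedSpace.exp_series_hasSum_exp' (𝕂 := ℂ) A)
  simp only [Finset.range_one, Finset.sum_singleton, pow_zero, Nat.factorial_zero, Nat.cast_one,
    inv_one, one_smul] at h
  exact mem_strictLower_of_hasSum h fun n =>
    Submodule.smul_mem _ _ (pow_succ_mem_strictLower hA n)

theorem mul_sub_one_mem_strictLower {N : ℤ} {A B : H →L[ℂ] H} (hA : A - 1 ∈ strictLower N)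
    (hB : B - 1 ∈ strictLower N) : A * B - 1 ∈ strictLower N := by
  have e : A * B - 1 = (A - 1) * (B - 1) + (A - 1) + (B - 1) := by noncomm_ring
  rw [e]
  exact Submodule.add_mem _ (Submodule.add_mem _ (mul_mem_strictLower hA hB) hA) hB

theorem flow_sub_one_mem_strictLower {N : ℤ} {S : H →L[ℂ] H} (hS : S ∈ strictLower N)
    {t : ℕ+ → ℂ} (ht : TimeConverges S t) : flow S t - 1 ∈ strictLower N := by
  refine exp_sub_one_mem_strictLower (mem_strictLower_of_hasSum ht.hasSum fun i => ?_)
  refine Submodule.smul_mem _ _ ?_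
  rw [← Nat.succ_pred_eq_of_pos i.pos]
  exact pow_succ_mem_strictLower hS _

theorem shiftedFlow_sub_one_mem_strictLower {N : ℤ} {S : H →L[ℂ] H} (hS : S ∈ strictLower N)
    {t : ℕ+ → ℂ} (ht : TimeConverges S t) {m : ℕ} (x : Fin m → ℂ) :
    shiftedFlow S t x - 1 ∈ strictLower N := by
  induction m with
  | zero => simpa [shiftedFlow] using flow_sub_one_mem_strictLower hS ht
  | succ m ih =>
    rw [shiftedFlow, List.ofFn_succ, List.prod_cons, mul_assoc]
    refine mul_sub_one_mem_strictLower ?_ (ih fun a => x a.succ)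
    rw [add_sub_cancel_left]
    exact Submodule.smul_mem _ _ hS

theorem entry_of_sub_one_mem {N : ℤ} {M : H →L[ℂ] H} (hM : M - 1 ∈ strictLower N) {i j : ℤ}
    (hi : N ≤ i) (hj : j ≤ i) : entry M j i = if j = i then 1 else 0 := by
  have h := hM i hi j hj
  have e : entry (M - 1) j i = entry M j i - (SatoKP.e i : H) j := rfl
  rwa [e, sub_eq_zero, e_apply] at h

end Entries

/-! ### Reduction of infinite determinants to finite ones -/

section Truncation

theorem truncDet_succ {A : ℕ → ℕ → ℂ} {n : ℕ} (h0 : ∀ a < n, A a n = 0) (h1 : A n n = 1) :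
    truncDet A (n + 1) = truncDet A n := by
  rw [truncDet, Matrix.det_succ_column _ (Fin.last n), Fin.sum_univ_castSucc,
    Finset.sum_eq_zero fun a _ => by simp [h0 a a.2]]
  simp only [Matrix.of_apply, Fin.val_last, h1, zero_add, mul_one, ← two_mul, pow_mul]
  simp only [even_two, Even.neg_pow, one_pow, one_mul, truncDet]
  congr 1
  ext a b
  simp [Fin.succAbove_last]

theorem truncDet_eq_of_le {A : ℕ → ℕ → ℂ} {m : ℕ} (h0 : ∀ n, m ≤ n → ∀ a < n, A a n = 0)
    (h1 : ∀ n, m ≤ n → A n n = 1) {n : ℕ} (hn : m ≤ n) : truncDet A n = truncDet A m := by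
  induction n, hn using Nat.le_induction with
  | base => rfl
  | succ n hn ih => rw [truncDet_succ (h0 n hn) (h1 n hn), ih]

theorem tendsto_truncDet {A : ℕ → ℕ → ℂ} {m : ℕ} (h0 : ∀ n, m ≤ n → ∀ a < n, A a n = 0)
    (h1 : ∀ n, m ≤ n → A n n = 1) : Tendsto (truncDet A) atTop (𝓝 (truncDet A m)) :=
  tendsto_const_nhds.congr' (eventually_atTop.mpr ⟨m, fun _ hn =>
    (truncDet_eq_of_le h0 h1 hn).symm⟩)

theorem tendsto_truncDet_entry {m : ℕ} {M : H →L[ℂ] H} (hM : M - 1 ∈ strictLower m)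
    {I : MultiIndex} (hI : ∀ j, m ≤ j → I.1 j = (j : ℤ)) :
    Tendsto (truncDet fun a b => entry M (ground.1 a) (I.1 b)) atTop
      (𝓝 (truncDet (fun a b => entry M (ground.1 a) (I.1 b)) m)) := by
  refine tendsto_truncDet (fun n hn a ha => ?_) fun n hn => ?_
  · rw [hI n hn, entry_of_sub_one_mem hM (by exact_mod_cast hn)]
    · exact if_neg (by simp [ground]; omega)
    · simp [ground]; omega
  · rw [hI n hn, entry_of_sub_one_mem hM (by exact_mod_cast hn)]
    · exact if_pos rfl
    · simp [ground]

theorem minor_ground_eq {m : ℕ} {M : H →L[ℂ] H} (hM : M - 1 ∈ strictLower m)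
    {I : MultiIndex} (hI : ∀ j, m ≤ j → I.1 j = (j : ℤ)) :
    minor M ground I = (Matrix.of fun a b : Fin m => entry M (a : ℕ) (I.1 b)).det :=
  (tendsto_truncDet_entry hM hI).limUnder_eq

theorem strictLower_mono {N N' : ℤ} (h : N ≤ N') : strictLower N ≤ strictLower N' :=
  fun _ hM i hi => hM i (h.trans hi)

/-- The multi-indices with `i_j = j` for all `j ≥ m`. -/
abbrev BoundedIndex (m : ℕ) : Type := {I : MultiIndex // ∀ j, m ≤ j → I.1 j = (j : ℤ)}

/-- The first `m` entries of a bounded multi-index. -/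
def BoundedIndex.init {m : ℕ} (I : BoundedIndex m) : Fin m ↪o ℤ :=
  OrderEmbedding.ofStrictMono (fun a => I.1.1 a) fun _ _ h => I.1.2.1 h

theorem BoundedIndex.init_injective {m : ℕ} :
    Function.Injective (BoundedIndex.init (m := m)) := by
  intro I J h
  refine Subtype.ext (Subtype.ext (funext fun j => ?_))
  by_cases hj : j < m
  · exact DFunLike.congr_fun h ⟨j, hj⟩
  · rw [I.2 j (by omega), J.2 j (by omega)]

theorem BoundedIndex.mem_range_init {m : ℕ} (f : Fin m ↪o ℤ) (hf : ∀ a, f a < m) :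
    f ∈ Set.range (BoundedIndex.init (m := m)) := by
  refine ⟨⟨⟨fun j => if h : j < m then f ⟨j, h⟩ else j, ?_, ?_⟩, ?_⟩, ?_⟩
  · intro i j hij
    by_cases hj : j < m
    · simp only [hj, hij.trans hj, dif_pos]
      exact f.strictMono hij
    · by_cases hi : i < m
      · simp only [hi, hj, dif_pos, dif_neg, not_false_eq_true]
        have := hf ⟨i, hi⟩
        omega
      · simp only [hi, hj, dif_neg, not_false_eq_true]
        omega
  · exact eventually_atTop.mpr ⟨m, fun j hj => dif_neg (by omega)⟩
  · exact fun j hj => dif_neg (by omega)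
  · ext a
    exact dif_pos a.2

theorem support_subset_range_of_bounded {m : ℕ} {ω : Wedge}
    (hω : ∀ I : MultiIndex, (ω : MultiIndex → ℂ) I ≠ 0 → ∀ j, m ≤ j → I.1 j = (j : ℤ))
    (c : MultiIndex → ℂ) (I : MultiIndex)
    (hI : I ∉ Set.range (Subtype.val : BoundedIndex m → MultiIndex)) :
    (ω : MultiIndex → ℂ) I * c I = 0 := by
  by_contra h
  exact hI ⟨⟨I, hω I (left_ne_zero_of_mul h)⟩, rfl⟩

theorem exists_bound (ω : Wedge) (p : ℕ) : ∃ m, p ≤ m ∧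
    ∀ I : MultiIndex, (ω : MultiIndex → ℂ) I ≠ 0 → ∀ j, m ≤ j → I.1 j = (j : ℤ) := by
  obtain ⟨-, m, hm⟩ := ω.2
  exact ⟨max p m, le_max_left _ _, fun I hI j hj => hm I hI j ((le_max_right _ _).trans hj)⟩

/-- The minors of a unipotent lower triangular operator, and their sums, converge. -/
theorem hatCoordConverges_of_sub_one_mem {N : ℤ} {M : H →L[ℂ] H} (hM : M - 1 ∈ strictLower N)
    (ω : Wedge) : HatCoordConverges M ω ground := by
  refine ⟨fun I => ?_, ?_⟩
  · obtain ⟨p, hp⟩ := eventually_atTop.mp I.2.2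
    exact ⟨_, tendsto_truncDet_entry (m := max N.toNat p)
      (strictLower_mono (by push_cast; omega) hM) fun j hj => hp j ((le_max_right _ _).trans hj)⟩
  · obtain ⟨m, hm, hω⟩ := exists_bound ω N.toNat
    have hM' : M - 1 ∈ strictLower m := strictLower_mono (by omega) hM
    rw [← Subtype.val_injective.summable_iff (support_subset_range_of_bounded hω _)]
    -- In the Leibniz expansion each term pairs the square summable ω with a product of entries from
    -- m square summable rows; such products are square summable even over all tuples in ℤᵐ.
    have e : ∀ I : BoundedIndex m, (ω : MultiIndex → ℂ) I.1 * minor M ground I.1 =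
        ∑ σ : Equiv.Perm (Fin m), ((Equiv.Perm.sign σ : ℤ) : ℂ) * ((ω : MultiIndex → ℂ) I.1 *
          ∏ b : Fin m, entry M ((σ b : ℕ) : ℤ) (I.init b)) := fun I => by
      rw [minor_ground_eq hM' I.2, Matrix.det_apply', Finset.mul_sum]
      exact Finset.sum_congr rfl fun σ _ => mul_left_comm _ _ _
    simp only [Function.comp_def, e]
    refine summable_sum fun σ _ => Summable.mul_left _ (Summable.of_norm ?_)
    refine summable_norm_mul_of_sq ?_ ?_
    · exact (summable_norm_sq_of_memℓp ω.2.1).comp_injective Subtype.val_injective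
    · have h := (summable_prod_pi_and_tsum
        (fun (b : Fin m) (l : ℤ) => entry M ((σ b : ℕ) : ℤ) l ^ 2) fun b => by
          simpa only [norm_pow] using summable_norm_sq_entry M _).1
      have hinj : Function.Injective fun (I : BoundedIndex m) (b : Fin m) => I.init b :=
        fun I J hIJ => BoundedIndex.init_injective (DFunLike.coe_injective hIJ)
      refine (h.comp_injective hinj).congr fun I => ?_
      rw [Function.comp_apply, Finset.prod_pow, norm_pow]

/-- The coordinate at the ground state of `M̂ (v₀ ∧ v₁ ∧ ⋯)` is the leading minor of size `m` of
`(M v₀ | M v₁ | ⋯)`, for large `m`. -/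
theorem hatCoord_ground_eq_det {m : ℕ} {M : H →L[ℂ] H} (hM : M - 1 ∈ strictLower m) {ω : Wedge}
    (hω : ∀ I : MultiIndex, (ω : MultiIndex → ℂ) I ≠ 0 → ∀ j, m ≤ j → I.1 j = (j : ℤ))
    {v : ℕ → H} (hv : ∀ i : ℕ, m ≤ i → (v i) (i : ℤ) = 1 ∧ ∀ j : ℤ, j < i → (v i) j = 0)
    (hωv : IsInfiniteWedge ω v) :
    hatCoord M ω ground = (Matrix.of fun a b : Fin m => (M (v b)) ((a : ℕ) : ℤ)).det := by
  have h1 : ∀ I : BoundedIndex m, (ω : MultiIndex → ℂ) I.1 =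
      (Matrix.of fun a b : Fin m => (v b) (I.init a)).det := fun I => by
    refine tendsto_nhds_unique (hωv I.1) (tendsto_truncDet (m := m) (fun n hn a ha => ?_)
      fun n hn => ?_)
    · exact (hv n hn).2 _ (by rw [← I.2 n hn]; exact I.1.2.1 ha)
    · rw [I.2 n hn]
      exact (hv n hn).1
  have h2 := hasSum_det_mul_det (fun (a : Fin m) l => entry M ((a : ℕ) : ℤ) l)
    (fun (b : Fin m) l => (v b) l) fun a b =>
      summable_norm_mul_of_sq (summable_norm_sq_entry M _)
        (summable_norm_sq_of_memℓp (lp.memℓp (v b)))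
  rw [hatCoord, ← Subtype.val_injective.tsum_eq
    (f := fun I : MultiIndex => (ω : MultiIndex → ℂ) I * minor M ground I)
    (Function.support_subset_iff'.mpr (support_subset_range_of_bounded hω _))]
  have e : (Matrix.of fun a b : Fin m => (M (v b)) ((a : ℕ) : ℤ)) =
      Matrix.of fun a b : Fin m => ∑' l, entry M ((a : ℕ) : ℤ) l * (v b) l := by
    ext a b
    exact (hasSum_entry_mul M (v b) _).tsum_eq.symm
  rw [e, ← h2.tsum_eq, ← BoundedIndex.init_injective.tsum_eq]
  · refine tsum_congr fun I => ?_
    rw [h1, minor_ground_eq hM I.2]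
    rfl
  · refine Function.support_subset_iff'.mpr fun f hf => ?_
    -- Tuples outside the range of `init` have an entry ≥ m, and the corresponding column of M
    -- vanishes in the rows 0, …, m - 1.
    have : ∃ b, (m : ℤ) ≤ f b := by
      by_contra! hlt
      exact hf (BoundedIndex.mem_range_init f hlt)
    obtain ⟨b, hb⟩ := this
    rw [Matrix.det_eq_zero_of_column_eq_zero (A := Matrix.of fun a b : Fin m =>
      entry M ((a : ℕ) : ℤ) (f b)) b fun a => ?_, mul_zero]
    rw [Matrix.of_apply, entry_of_sub_one_mem hM hb (by omega), if_neg (by omega)]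

theorem hatCoord_add {N : ℤ} {M : H →L[ℂ] H} (hM : M - 1 ∈ strictLower N) (ω η : Wedge) :
    hatCoord M (ω + η) ground = hatCoord M ω ground + hatCoord M η ground := by
  rw [hatCoord, hatCoord, hatCoord, ← (hatCoordConverges_of_sub_one_mem hM ω).2.tsum_add
    (hatCoordConverges_of_sub_one_mem hM η).2]
  exact tsum_congr fun I => add_mul _ _ _

theorem hatCoord_smul (M : H →L[ℂ] H) (c : ℂ) (ω : Wedge) :
    hatCoord M (c • ω) ground = c * hatCoord M ω ground := by
  rw [hatCoord, hatCoord, ← tsum_mul_left]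
  exact tsum_congr fun I => mul_assoc _ _ _

end Truncation

/-! ### The rank condition on S₊₋ -/

section RankOne

theorem coord_projection_of_mem {s : Set ℤ}
    [((Submodule.span ℂ (e '' s)).topologicalClosure).HasOrthogonalProjection] (w : H) {j : ℤ}
    (hj : j ∈ s) :
    ((Submodule.span ℂ (e '' s)).topologicalClosure.orthogonalProjectionOnto w : H) j = w j := by
  have hm : e j ∈ (Submodule.span ℂ (e '' s)).topologicalClosure :=
    Submodule.le_topologicalClosure _ (Submodule.subset_span ⟨j, hj, rfl⟩)
  have h := Submodule.inner_orthogonalProjectionOnto_eq_of_mem_left ⟨e j, hm⟩ w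
  rw [Submodule.coe_inner] at h
  rwa [← coordCLM_apply, ← coordCLM_apply]

theorem coord_eq_zero_of_mem_closure {s : Set ℤ} {w : H}
    (hw : w ∈ (Submodule.span ℂ (e '' s)).topologicalClosure) {j : ℤ} (hj : j ∉ s) : w j = 0 := by
  have hle : (Submodule.span ℂ (e '' s)).topologicalClosure ≤ (coordCLM j).ker := by
    refine Submodule.topologicalClosure_minimal _ (Submodule.span_le.mpr ?_)
      (coordCLM j).isClosed_ker
    rintro _ ⟨i, hi, rfl⟩
    have hij : j ≠ i := fun h => hj (h ▸ hi)
    rw [SetLike.mem_coe, LinearMap.mem_ker]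
    exact (coordCLM_apply _ _).trans ((e_apply _ _).trans (if_neg hij))
  have := hle hw
  rw [LinearMap.mem_ker] at this
  exact (coordCLM_apply j w).symm.trans this

instance instCompleteSpaceHminus : CompleteSpace Hminus :=
  (Submodule.isClosed_topologicalClosure _).completeSpace_coe

/-- If `S₊₋` has rank at most one, then it is given by a functional and a vector. -/
theorem exists_functional_of_rank_le_one (S : H →L[ℂ] H)
    (hrank : LinearMap.rank (blockPlusMinus S : Hminus →ₗ[ℂ] Hplus) ≤ 1) :
    ∃ (φ : H →ₗ[ℂ] ℂ) (u : Hplus),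
      ∀ w, blockPlusMinus S (Hminus.orthogonalProjectionOnto w) = φ w • u := by
  obtain ⟨u, hu⟩ := (rank_submodule_le_one_iff' _).mp hrank
  -- φ reads off the coefficient along u; for u = 0 both sides vanish, whatever the value of the
  -- inverse.
  refine ⟨((‖u‖ : ℂ) ^ 2)⁻¹ • (innerSL ℂ u ∘L blockPlusMinus S ∘L
    Hminus.orthogonalProjectionOnto : H →ₗ[ℂ] ℂ), u, fun w => ?_⟩
  obtain ⟨c, hc⟩ := Submodule.mem_span_singleton.mp
    (hu ⟨Hminus.orthogonalProjectionOnto w, rfl⟩)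
  change c • u = blockPlusMinus S (Hminus.orthogonalProjectionOnto w) at hc
  change _ = (((‖u‖ : ℂ) ^ 2)⁻¹ •
    inner ℂ u (blockPlusMinus S (Hminus.orthogonalProjectionOnto w))) • u
  have e : inner ℂ u (c • u) = c * (‖u‖ : ℂ) ^ 2 := by
    refine (inner_smul_right (𝕜 := ℂ) u u c).trans ?_
    rw [inner_self_eq_norm_sq_to_K]
    rfl
  rw [← hc, e, smul_eq_mul]
  by_cases h0 : u = 0
  · simp [h0]
  · have : (‖u‖ : ℂ) ^ 2 ≠ 0 := by simpa using h0
    congr 1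
    rw [mul_comm c]
    exact (inv_mul_cancel_left₀ this c).symm

/-- The projection on the coordinates `0, …, m - 1`. -/
def firstCoords (m : ℕ) : H →L[ℂ] (Fin m → ℂ) :=
  ContinuousLinearMap.pi fun a => coordCLM ((a : ℕ) : ℤ)

theorem firstCoords_apply (m : ℕ) (w : H) (a : Fin m) :
    firstCoords m w a = w ((a : ℕ) : ℤ) := coordCLM_apply _ _

/-- The component of w in H₋ contributes φ(w) u, the coordinates 0, …, m - 1 contribute through the
finite block, and the columns of S from m on vanish in the rows below m. -/
theorem firstCoords_intertwine {S : H →L[ℂ] H} {φ : H →ₗ[ℂ] ℂ} {u : Hplus}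
    (h : ∀ w, blockPlusMinus S (Hminus.orthogonalProjectionOnto w) = φ w • u) {m : ℕ}
    (hS : S ∈ strictLower m) (w : H) :
    firstCoords m (S w) =
      (Matrix.of fun a b : Fin m => entry S (a : ℕ) (b : ℕ)).mulVec (firstCoords m w) +
        φ w • firstCoords m u := by
  ext a
  set z : H := (Hminus.orthogonalProjectionOnto w : H) with hz
  have hneg : ∀ l : ℤ, l < 0 → (w - z) l = 0 := fun l hl => by
    have : z l = w l := coord_projection_of_mem (s := {i : ℤ | i < 0}) w hl
    rw [lp.coeFn_sub, Pi.sub_apply, this, sub_self]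
  have hpos : ∀ l : ℤ, 0 ≤ l → (w - z) l = w l := fun l hl => by
    have : z l = 0 := coord_eq_zero_of_mem_closure (s := {i : ℤ | i < 0})
      (Hminus.orthogonalProjectionOnto w).2 (by simpa using hl)
    rw [lp.coeFn_sub, Pi.sub_apply, this, sub_zero]
  have h1 : (S z) ((a : ℕ) : ℤ) = φ w * (u : H) ((a : ℕ) : ℤ) := by
    have e1 : ((blockPlusMinus S (Hminus.orthogonalProjectionOnto w) : Hplus) : H)
        ((a : ℕ) : ℤ) = (S z) ((a : ℕ) : ℤ) :=
      coord_projection_of_mem (s := {i : ℤ | 0 ≤ i}) (S z) (Int.natCast_nonneg _)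
    rw [← e1, h w]
    rfl
  have h2 : (S (w - z)) ((a : ℕ) : ℤ) =
      ∑ b : Fin m, entry S (a : ℕ) (b : ℕ) * w ((b : ℕ) : ℤ) := by
    have hinj : Function.Injective fun b : Fin m => ((b : ℕ) : ℤ) := fun b c hbc =>
      Fin.ext (Int.ofNat_inj.mp hbc)
    have e1 := (hinj.hasSum_iff fun l hl => ?_).mpr (hasSum_entry_mul S (w - z) ((a : ℕ) : ℤ))
    · rw [e1.unique (hasSum_fintype _)]
      exact Finset.sum_congr rfl fun b _ => by
        rw [Function.comp_apply, hpos _ (Int.natCast_nonneg _)]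
    · rcases lt_or_ge l 0 with hl0 | hl0
      · rw [hneg l hl0, mul_zero]
      · rcases lt_or_ge l m with hlm | hlm
        · exact absurd ⟨⟨l.toNat, by omega⟩, by simpa using hl0⟩ hl
        · rw [hS l hlm _ (by have := a.2; omega), zero_mul]
  rw [Pi.add_apply, Pi.smul_apply, firstCoords_apply, firstCoords_apply, smul_eq_mul, ← h1,
    Matrix.mulVec, dotProduct]
  simp only [firstCoords_apply, Matrix.of_apply]
  rw [← h2, ← Pi.add_apply, ← lp.coeFn_add, ← map_add, sub_add_cancel]

end RankOne

/-! ### The matrix of minors and the Grassmann cone -/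

/-- On the Sato cone, the Vandermonde multiples of the shifted function `τ` are the minors of a
matrix. -/
theorem exists_matrix_shiftedTauExt {k n : ℕ} (hk : 0 < k) {S : H →L[ℂ] H}
    (hS : AlmostLowerTriangular S)
    (hrank : LinearMap.rank (blockPlusMinus S : Hminus →ₗ[ℂ] Hplus) ≤ 1)
    {t : ℕ+ → ℂ} (ht : TimeConverges S t) (lam : Fin n → ℂ) {ω : Wedge} (hω : ω ∈ satoCone) :
    ∃ B : Matrix (Fin k) (Fin n) ℂ, ∀ I : Fin k → Fin n,
      vanDet (fun a => lam (I a)) * shiftedTauExt S t (fun a => lam (I a)) ω =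
        (B.submatrix id I).det := by
  obtain ⟨N, hN⟩ := hS
  obtain ⟨v, ⟨p, hv⟩, hωv⟩ := hω
  -- One truncation size m serves S, the vectors v and the support of ω.
  obtain ⟨m, hm, hωm⟩ := exists_bound ω (max N.toNat p)
  have hSm : S ∈ strictLower m :=
    strictLower_mono (by have := (le_max_left _ _).trans hm; omega) hN
  obtain ⟨φ, u, hφ⟩ := exists_functional_of_rank_le_one S hrank
  set A : Matrix (Fin m) (Fin m) ℂ := Matrix.of fun a b => entry S (a : ℕ) (b : ℕ) with hA
  set w : Fin m → H := fun b => flow S t (v b) with hw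
  -- Column r involves λ_r alone, so one matrix serves all index tuples I, including those with
  -- repetitions.
  set g : Matrix (Fin k ⊕ Fin m) (Fin n) ℂ := Matrix.fromRows
    (Matrix.of fun (j : Fin k) r => (1 + lam r • A).det * lam r ^ (j : ℕ))
    (Matrix.of fun a r => -(lam r ^ k * (1 + lam r • A).adjugate.mulVec (firstCoords m u) a))
    with hg
  obtain ⟨B, hB⟩ := exists_det_fromCols_eq hk (Matrix.fromRows
    (Matrix.of fun (j : Fin k) b =>
        (-1) ^ (k - 1 - (j : ℕ)) * φ ((S ^ (k - 1 - (j : ℕ))) (w b)))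
    (Matrix.of fun a b => firstCoords m (w b) a))
  refine ⟨B * g, fun I => ?_⟩
  have h1 := det_bordered S (firstCoords m) A (firstCoords m u) φ
    (firstCoords_intertwine hφ hSm) (fun a => lam (I a)) w
  rw [← Matrix.fromCols_fromRows_eq_fromBlocks] at h1
  have h2 : (B * g).submatrix id I = B * g.submatrix id I := by
    rw [Matrix.submatrix_mul B g id id I Function.bijective_id, Matrix.submatrix_id_id]
  have h3 : g.submatrix id I = Matrix.fromRows
      (Matrix.of fun j i : Fin k => (1 + lam (I i) • A).det * lam (I i) ^ (j : ℕ))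
      (Matrix.of fun a (i : Fin k) =>
        -(lam (I i) ^ k * (1 + lam (I i) • A).adjugate.mulVec (firstCoords m u) a)) := by
    ext (a | a) i <;> rfl
  rw [h2, h3, ← hB, h1, shiftedTauExt, hatCoord_ground_eq_det
    (shiftedFlow_sub_one_mem_strictLower hSm ht _) hωm
    (fun i hi => hv i ((le_max_right _ _).trans (hm.trans hi))) hωv]
  simp only [firstCoords_apply]
  rfl

theorem isLinearMap_vandermondeMap {k n : ℕ} (lam : Fin n → ℂ) (F : (Fin k → ℂ) → Wedge → ℂ)
    (hF : ∀ x, IsLinearMap ℂ (F x)) : IsLinearMap ℂ (vandermondeMap lam F) := by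
  refine ⟨fun ω η => ?_, fun c ω => ?_⟩
  · simp only [vandermondeMap, ofPlucker, (hF _).map_add, mul_add, add_smul,
      Finset.sum_add_distrib]
  · simp only [vandermondeMap, ofPlucker, (hF _).map_smul, smul_eq_mul, Finset.smul_sum, smul_smul,
      mul_left_comm]

theorem isGCP_LhatExt {k n : ℕ} (hk : 0 < k) {S : H →L[ℂ] H} (hS : AlmostLowerTriangular S)
    (hrank : LinearMap.rank (blockPlusMinus S : Hminus →ₗ[ℂ] Hplus) ≤ 1)
    {t : ℕ+ → ℂ} (ht : TimeConverges S t) (lam : Fin n → ℂ) : IsGCP (LhatExt k n S t lam) := by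
  refine ⟨isLinearMap_vandermondeMap lam _ fun x => ?_, fun ω hω => ?_⟩
  · obtain ⟨N, hN⟩ := hS
    exact ⟨hatCoord_add (shiftedFlow_sub_one_mem_strictLower (N := N) hN ht x),
      hatCoord_smul _⟩
  · obtain ⟨B, hB⟩ := exists_matrix_shiftedTauExt hk hS hrank ht lam hω
    refine ⟨fun a => B a, ?_⟩
    rw [← ofPlucker_det, LhatExt, vandermondeMap]
    congr 1
    ext I
    exact (hB I).symm

end SatoKP

end

/-! ### The main theorem -/

open SatoKP
theorem mainTheorem2 (k n : ℕ) (hk : 0 < k) (hkn : k < n)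
    (S : H →L[ℂ] H) (hS : AlmostLowerTriangular S)
    (hrank : LinearMap.rank (blockPlusMinus S : Hminus →ₗ[ℂ] Hplus) ≤ 1)
    (t : ℕ+ → ℂ) (ht : TimeConverges S t) :
    -- the map `L̂_{k,n}`, for parameters at which the Miwa shifted times are admissible
    (∀ lam : Fin n → ℂ, (∀ r, TimeConverges S (miwa (lam r))) →
      (∀ (ω : Wedge) (I : Fin k ↪o Fin n),
        HatCoordConverges (flow S (t + ∑ a, miwa (lam (I a)))) ω ground) ∧
      IsGCP (Lhat k n S t lam) ∧
      ∀ ω ∈ satoCone, PluckerRelations k n fun {m} (i : Fin m → Fin n) =>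
        vanDet (fun a => lam (i a)) * tau S ω (t + ∑ a, miwa (lam (i a)))) ∧
    -- the same for arbitrary parameters, after extension of the shifted function `τ`
    (∀ (ω : Wedge) (x : Fin k → ℂ), (∀ a, TimeConverges S (miwa (x a))) →
      shiftedTauExt S t x ω = tau S ω (t + ∑ a, miwa (x a))) ∧
    (∀ lam : Fin n → ℂ,
      (∀ (ω : Wedge) (I : Fin k ↪o Fin n),
        HatCoordConverges (shiftedFlow S t fun a => lam (I a)) ω ground) ∧
      IsGCP (LhatExt k n S t lam) ∧
      ∀ ω ∈ satoCone, PluckerRelations k n fun {m} (i : Fin m → Fin n) =>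
        vanDet (fun a => lam (i a)) * shiftedTauExt S t (fun a => lam (i a)) ω) := by
  obtain ⟨N, hN⟩ := id hS
  have hflow : ∀ {m : ℕ} (x : Fin m → ℂ), (∀ a, TimeConverges S (miwa (x a))) →
      flow S (t + ∑ a, miwa (x a)) = shiftedFlow S t x := fun x hx =>
    (flow_add_sum_miwa S ht x hx).2
  have htau : ∀ {m : ℕ} (ω : Wedge) (x : Fin m → ℂ), (∀ a, TimeConverges S (miwa (x a))) →
      shiftedTauExt S t x ω = tau S ω (t + ∑ a, miwa (x a)) := fun ω x hx => by
    rw [tau, hflow x hx, shiftedTauExt]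
  have hconv : ∀ (ω : Wedge) (x : Fin k → ℂ), HatCoordConverges (shiftedFlow S t x) ω ground :=
    fun ω x => hatCoordConverges_of_sub_one_mem
      (shiftedFlow_sub_one_mem_strictLower (N := N) hN ht x) ω
  refine ⟨fun lam hlam => ⟨fun ω I => ?_, ?_, fun ω hω => ?_⟩, fun ω x hx => htau ω x hx,
    fun lam => ⟨fun ω I => hconv ω _, isGCP_LhatExt hk hS hrank ht lam, fun ω hω => ?_⟩⟩
  · rw [hflow _ fun a => hlam (I a)]
    exact hconv ω _
  · have e : Lhat k n S t lam = LhatExt k n S t lam := by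
      ext1 ω
      rw [Lhat, LhatExt, vandermondeMap, vandermondeMap]
      congr 1
      ext I
      rw [htau ω _ fun a => hlam (I a), shiftedTau]
    exact e ▸ isGCP_LhatExt hk hS hrank ht lam
  · obtain ⟨B, hB⟩ := exists_matrix_shiftedTauExt hk hS hrank ht lam hω
    refine pluckerRelations_det hk _ B fun I => ?_
    rw [← hB I, htau ω _ fun a => hlam (I a)]
  · obtain ⟨B, hB⟩ := exists_matrix_shiftedTauExt hk hS hrank ht lam hω
    exact pluckerRelations_det hk _ B fun I => hB I
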